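/- **Setting.** Let $d\ge 1$, $k\ge 2$. Let $\mathbf Y=\{(Y_{n1},\dots,Y_{nd})\}_{n\ge1}$ be a stationary sequence whose coordinates have Pareto-type distribution functions $F_{Y_j}(x)=1-x^{-\beta_j}l_{Y_j}(x)$, $x>0$, with $\beta_j>0$ and $l_{Y_j}$ slowly varying at infinity. Let $\mathbf T=\{(T_{n1},\dots,T_{nd})\}_{n\ge1}$ be a stationary sequence, independent of $\mathbf Y$, with $T_{nj}\ge 0$ a.s., $T_{nj}$ not a.s. zero, and $E(T_{nj}^{\epsilon_j})<\infty$ for some $\epsilon_j>\beta_j$. Put $X_{nj}=Y_{nj}T_{nj}$ and $r_j=E(T_{1j}^{\beta_j})$. Inequalities between vectors are coordinatewise ($\mathbf a\not\le\mathbf b$: some coordinate of $\mathbf a$ exceeds that of $\mathbf b$), and so are products, quotients and powers of vectors. $U_Z(s)=\inf\{y: F_Z(y)\ge 1-1/s\}$, $0\le s\le\infty$ (so $U_{Y_j}(t/0)=U_{Y_j}(\infty)=\infty$), and $\mathbf U_{\mathbf Y}(\mathbf s)=(U_{Y_1}(s_1),\dots,U_{Y_d}(s_d))$, with $U_{Y_j}$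 the function for $Y_{1j}$; similarly for $\mathbf X$. *Tail functions.* For $\emptyset\ne S\subseteq\{1,\dots,k\}$ and $\mathbf x_i\in[0,\infty)^d$, $$\Lambda_{(\mathbf Y_1,\dots,\mathbf Y_k)_S}\big((\mathbf x_i)_{i\in S}\big)=\lim_{t\to\infty}t\,P\Big(\bigcap_{i\in S}\{\mathbf Y_i\not\le\mathbf U_{\mathbf Y}(t/\mathbf x_i)\}\Big),$$ and $\Lambda_{(Y_{1j},\dots,Y_{kj})_S}$ is the same function for the univariate sequence $\{Y_{nj}\}_n$. For $\emptyset\neq I\subseteq\{1,\dots,d\}$, $\Lambda_{(\mathbf Y_1)_I}(\mathbf x_I)=\lim_{t\to\infty}tP\big(\bigcap_{j\in I}\{Y_{1j}>U_{Y_j}(t/x_j)\}\big)$. *Normalized levels.* For $\boldsymbol\tau\in[0,\infty)^d$, $\boldsymbol\tau\neq\mathbf 0$, vectors $\mathbf u_n\in[-\infty,\infty]^d$ are normalized levels for $\boldsymbol\tau$ if $nP(X_{1j}>u_{nj})\to\tau_j$ for all $j$. *Mixing.* $\alpha(s)=\sup|P(A\cap B)-P(A)P(B)|$ over $p\ge1$,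 $A\in\sigma(\mathbf X_1,\dots,\mathbf X_p)$, $B\in\sigma(\mathbf X_{p+s},\mathbf X_{p+s+1},\dots)$; $\mathbf X$ is strong-mixing if $\alpha(s)\to0$. *Condition $D^{(k)}(\mathbf u_n)$.* There are integers $k_n,l_n$ with $k_n\to\infty$, $n/k_n\to\infty$, $k_nl_n/n\to0$, $k_n\alpha(l_n)\to0$ and $$\lim_{n\to\infty}n\sum_{i=k}^{[n/k_n]}P(\mathbf X_1\not\le\mathbf u_n,\ \mathbf X_i\le\mathbf u_n,\ \mathbf X_{i+1}\not\le\mathbf u_n)=0 .$$ We say that $D^{(k)}(\mathbf u_n^{(\boldsymbol\tau)})$ holds if $D^{(k)}(\mathbf u_n)$ holds for some normalized levels $\mathbf u_n$ for $\boldsymbol\tau$. *Extremal index.* Let $\mathbf M_n$ be the vector of coordinatewise maxima of $\mathbf X_1,\dots,\mathbf X_n$, and $\widehat{\mathbf M}_n$ that of $n$ independent copies of $\mathbf X_1$. $\mathbf X$ has multivariate extremal index $\theta_{\mathbf X}(\boldsymbol\tau)=\theta$ at $\boldsymbol\tau$ if normalized levels for $\boldsymbol\tau$ exist and there are $G>0$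 and $\widehat G\in(0,1)$ such that for all of them $P(\mathbf M_n\le\mathbf u_n)\to G$, $P(\widehat{\mathbf M}_n\le\mathbf u_n)\to\widehat G$, and $\theta=(-\log G)/(-\log\widehat G)$. The extremal index $\theta_{X_j}$ of $\{X_{nj}\}_n$ is this notion for $d=1$, with the same value at every $\tau>0$. **Statement.** Suppose that $\mathbf X$ is strong-mixing and that the limits $\Lambda_{(\mathbf Y_1,\dots,\mathbf Y_k)_{I\cup\{k\}}}$ exist in $\mathbb R$ for all $I\subseteq\{1,\dots,k-1\}$ and all arguments in $[0,\infty)^d$. 1. If $\boldsymbol\tau\in[0,\infty)^d\setminus\{\mathbf 0\}$ and $D^{(k)}(\mathbf u_n^{(\boldsymbol\tau)})$ holds, then $\mathbf X$ has at $\boldsymbol\tau$ the multivariate extremal index $$\theta_{\mathbf X}(\boldsymbol\tau)=1-\frac{E\Big(\sum_{\emptyset\ne I\subseteq\{1,\dots,k-1\}}(-1)^{|I|+1}\Lambda_{(\mathbf Y_1,\dots,\mathbf Y_k)_{I\cup\{k\}}}\Big(\frac{\boldsymbol\tau\mathbf T_1^{\boldsymbol\beta}}{\mathbf r},\dots,\frac{\boldsymbol\tau\mathbf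 T_k^{\boldsymbol\beta}}{\mathbf r}\Big)_{I\cup\{k\}}\Big)}{E\Big(\sum_{\emptyset\ne I\subseteq\{1,\dots,d\}}(-1)^{|I|-1}\Lambda_{(\mathbf Y_1)_I}\Big(\frac{\boldsymbol\tau\mathbf T_1^{\boldsymbol\beta}}{\mathbf r}\Big)_I\Big)}.$$ 2. Let $1\le j\le d$, and let $D^{(k)}(\mathbf u_n^{(s\mathbf e_j)})$ hold for all $s>0$, $\mathbf e_j$ being the $j$-th unit vector. Then $\{X_{nj}\}_n$ has extremal index $$\theta_{X_j}=1-\frac1{r_j}E\Big(\sum_{\emptyset\ne I\subseteq\{1,\dots,k-1\}}(-1)^{|I|+1}\Lambda_{(Y_{1j},\dots,Y_{kj})_{I\cup\{k\}}}\big(T_{1j}^{\beta_j},\dots,T_{kj}^{\beta_j}\big)_{I\cup\{k\}}\Big).$$ 3. If $\mathbf x\in(0,\infty)^d$ and $D^{(k)}(\mathbf u_n^{(1/\mathbf x)})$ holds, then $$\lim_{n\to\infty}P(\mathbf M_n\le\mathbf U_{\mathbf X}(n\mathbf x))=\exp\Big\{-E\Big(\sum_{I\subseteq\{1,\dots,k-1\}}(-1)^{|I|}\Lambda_{(\mathbf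 Y_1,\dots,\mathbf Y_k)_{I\cup\{k\}}}\Big(\frac{\mathbf T_1^{\boldsymbol\beta}}{\mathbf r\mathbf x},\dots,\frac{\mathbf T_k^{\boldsymbol\beta}}{\mathbf r\mathbf x}\Big)_{I\cup\{k\}}\Big)\Big\}.$$ 4. If $\mathbf Y_1,\dots,\mathbf Y_k$ are tail independent, i.e. $tP(Y_{1j}>U_{Y_j}(t),\,Y_{1+m,j'}>U_{Y_{j'}}(t))\to0$ as $t\to\infty$ for all $1\le m<k$ and all $j,j'$, then the extremal indices in 1 and 2 (under the conditions $D^{(k)}$ stated there) equal $1$. In particular all of this holds if $D^{(k)}(\mathbf u_n^{(\boldsymbol\tau)})$ is satisfied for all $\boldsymbol\tau\in[0,\infty)^d\setminus\{\mathbf 0\}$. -/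

import Mathlib

open MeasureTheory ProbabilityTheory Filter Topology
open scoped ENNReal

noncomputable section

/-!
Multivariate time series are families `X : ℕ → ι → Ω → ℝ`, where `X n j` is the `j`-th coordinate
of the random vector at time `n`. Times start at `0`, so that `X 0` is the first vector of the
series, usually written `X₁`, and `X (k - 1)` is the `k`-th one.
-/

namespace ScaleMixture

variable {Ω ι : Type*} [MeasurableSpace Ω]

/-- The law of the whole series is invariant under a shift of time. -/
def IsStationary (μ : Measure Ω) (X : ℕ → ι → Ω → ℝ) : Prop :=
  μ.map (fun ω (n : ℕ) (j : ι) => X n j ω) = μ.map (fun ω (n : ℕ) (j : ι) => X (n + 1) j ω)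

/-- Slow variation at infinity. -/
def IsSlowlyVarying (l : ℝ → ℝ) : Prop :=
  ∀ a : ℝ, 0 < a → Tendsto (fun x => l (a * x) / l x) atTop (𝓝 1)

/-- `Z` has a distribution function of Pareto type with index `β`:
`F_Z(x) = 1 - x ^ (-β) * l x` with `l` slowly varying. -/
def IsParetoType (μ : Measure Ω) (Z : Ω → ℝ) (β : ℝ) : Prop :=
  0 < β ∧ ∃ l : ℝ → ℝ, IsSlowlyVarying l ∧
    ∀ x : ℝ, 0 < x → μ.real {ω | Z ω ≤ x} = 1 - x ^ (-β) * l x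

/-- The tail quantile function `U_Z(s) = F_Z⁻¹(1 - 1/s)`, `s ∈ [0, ∞]`, where `F_Z⁻¹` is the
generalized inverse `p ↦ inf {y : p ≤ F_Z(y)}` with values in `[-∞, ∞]`.
In particular `U_Z(∞) = ∞` when `Z` is not bounded above. -/
def tailQuantile (μ : Measure Ω) (Z : Ω → ℝ) (s : ℝ≥0∞) : EReal :=
  sInf ((fun y : ℝ => (y : EReal)) '' {y : ℝ | 1 - s⁻¹ ≤ μ {ω | Z ω ≤ y}})

/-- The event that, at time `i`, coordinate `j` exceeds `U_j (t / x)`, where `U_j` is the tail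
quantile function of coordinate `j`. For `x = 0` the level is `U_j ∞`. -/
def tailEvent (μ : Measure Ω) (Y : ℕ → ι → Ω → ℝ) (t : ℝ) (i : ℕ) (j : ι) (x : ℝ) : Set Ω :=
  {ω | tailQuantile μ (Y 0 j) (ENNReal.ofReal t / ENNReal.ofReal x) < (Y i j ω : EReal)}

/-- `t * P(Y_i ≰ U_Y (t / x_i) for every i ∈ S)`, where `≰` means that some coordinate exceeds. -/
def preJointTail (μ : Measure Ω) (Y : ℕ → ι → Ω → ℝ) (S : Finset ℕ) (x : ℕ → ι → ℝ) (t : ℝ) : ℝ :=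
  t * μ.real (⋂ i ∈ S, ⋃ j : ι, tailEvent μ Y t i j (x i j))

/-- The joint tail function `Λ` of the vectors `Y_i`, `i ∈ S`, of a series, at the
arguments `x_i`, `i ∈ S`: the limit, as `t → ∞`, of
`t * P(Y_i ≰ U_Y (t / x_i) for every i ∈ S)`. -/
def jointTail (μ : Measure Ω) (Y : ℕ → ι → Ω → ℝ) (S : Finset ℕ) (x : ℕ → ι → ℝ) : ℝ :=
  limUnder atTop (preJointTail μ Y S x)

/-- The upper tail copula function `Λ` of the coordinates `j ∈ I` of the first vector:
the limit, as `t → ∞`, of `t * P(Y_{1j} > U_j (t / x_j) for every j ∈ I)`. -/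
def tailCopula (μ : Measure Ω) (Y : ℕ → ι → Ω → ℝ) (I : Finset ι) (x : ι → ℝ) : ℝ :=
  limUnder atTop fun t : ℝ => t * μ.real (⋂ j ∈ I, tailEvent μ Y t 0 j (x j))

/-- The univariate series of the `j`-th coordinates. -/
def marginal (X : ℕ → ι → Ω → ℝ) (j : ι) : ℕ → Unit → Ω → ℝ := fun n _ => X n j

/-- The strong-mixing coefficients: `α(s)` is the supremum of `|P(A ∩ B) - P(A) P(B)|` over all
`p`, all `A ∈ σ(X_i : i ≤ p)` and all `B ∈ σ(X_i : i ≥ p + s)`. -/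
def mixingCoeff (μ : Measure Ω) (X : ℕ → ι → Ω → ℝ) (s : ℕ) : ℝ :=
  sSup {a : ℝ | ∃ (p : ℕ) (A B : Set Ω),
    MeasurableSet[⨆ i ∈ Set.Iic p, ⨆ j, MeasurableSpace.comap (X i j) inferInstance] A ∧
    MeasurableSet[⨆ i ∈ Set.Ici (p + s), ⨆ j, MeasurableSpace.comap (X i j) inferInstance] B ∧
    a = |μ.real (A ∩ B) - μ.real A * μ.real B|}

def IsStrongMixing (μ : Measure Ω) (X : ℕ → ι → Ω → ℝ) : Prop :=
  Tendsto (mixingCoeff μ X) atTop (𝓝 0)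

/-- `u` is a sequence of vectors of normalized levels for `τ`:
`n * P(X_{1j} > u_{nj}) → τ_j` for each `j`. -/
def IsNormalizedLevels (μ : Measure Ω) (X : ℕ → ι → Ω → ℝ) (τ : ι → ℝ) (u : ℕ → ι → EReal) :
    Prop :=
  ∀ j, Tendsto (fun n : ℕ => (n : ℝ) * μ.real {ω | u n j < (X 0 j ω : EReal)}) atTop (𝓝 (τ j))

/-- The event `X_i ≤ v` (in every coordinate). -/
def belowEvent (X : ℕ → ι → Ω → ℝ) (i : ℕ) (v : ι → EReal) : Set Ω :=
  {ω | ∀ j, (X i j ω : EReal) ≤ v j}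

/-- The local dependence condition `D^(k)(u_n)`:
`n * ∑_{i = k}^{[n / k_n]} P(X_1 ≰ u_n, X_i ≤ u_n, X_{i+1} ≰ u_n) → 0`,
where `k_n → ∞`, `n / k_n → ∞` is a sequence of numbers of blocks which is admissible for the
mixing rate of the series: `k_n * l_n / n → 0` and `k_n * α(l_n) → 0` for some `l_n`. -/
def ConditionD (μ : Measure Ω) (X : ℕ → ι → Ω → ℝ) (k : ℕ) (u : ℕ → ι → EReal) : Prop :=
  ∃ kn ln : ℕ → ℕ,
    Tendsto kn atTop atTop ∧
    Tendsto (fun n : ℕ => (n : ℝ) / (kn n : ℝ)) atTop atTop ∧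
    Tendsto (fun n : ℕ => (kn n : ℝ) * (ln n : ℝ) / (n : ℝ)) atTop (𝓝 0) ∧
    Tendsto (fun n : ℕ => (kn n : ℝ) * mixingCoeff μ X (ln n)) atTop (𝓝 0) ∧
    Tendsto (fun n : ℕ => (n : ℝ) * ∑ i ∈ Finset.Icc k (n / kn n),
      μ.real ((belowEvent X 0 (u n))ᶜ ∩ belowEvent X (i - 1) (u n) ∩ (belowEvent X i (u n))ᶜ))
      atTop (𝓝 0)

/-- `D^(k)(u_n)` holds for some normalized levels `u_n` for `τ`. -/
def SatisfiesD (μ : Measure Ω) (X : ℕ → ι → Ω → ℝ) (k : ℕ) (τ : ι → ℝ) : Prop :=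
  ∃ u : ℕ → ι → EReal, IsNormalizedLevels μ X τ u ∧ ConditionD μ X k u

/-- The vector of componentwise maxima of the first `n` vectors of the series. -/
def compMax (X : ℕ → ι → Ω → ℝ) (n : ℕ) (ω : Ω) (j : ι) : EReal :=
  (Finset.range n).sup fun i => (X i j ω : EReal)

/-- `P(M_n ≤ v)` for the componentwise maxima `M_n` of the series. -/
def maxProb (μ : Measure Ω) (X : ℕ → ι → Ω → ℝ) (n : ℕ) (v : ι → EReal) : ℝ :=
  μ.real {ω | ∀ j, compMax X n ω j ≤ v j}

/-- `P(M̂_n ≤ v)` for the componentwise maxima `M̂_n` of `n` independent random vectors, each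
with the law of the first vector of the series. -/
def iidMaxProb (μ : Measure Ω) [IsProbabilityMeasure μ] (X : ℕ → ι → Ω → ℝ) (n : ℕ)
    (v : ι → EReal) : ℝ :=
  (Measure.pi fun _ : Fin n => μ.map fun ω (j : ι) => X 0 j ω).real
    {m : Fin n → ι → ℝ | ∀ j, (Finset.univ.sup fun i : Fin n => (m i j : EReal)) ≤ v j}

/-- The series has multivariate extremal index `θ` at `τ`: along normalized levels for `τ`
(they exist, and all of them give the same limits) `P(M_n ≤ u_n) → G > 0`,
`P(M̂_n ≤ u_n) → Ghat ∈ (0, 1)` and `θ = (- log G) / (- log Ghat)`. -/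
def HasExtremalIndexAt (μ : Measure Ω) [IsProbabilityMeasure μ] (X : ℕ → ι → Ω → ℝ)
    (τ : ι → ℝ) (θ : ℝ) : Prop :=
  (∃ u : ℕ → ι → EReal, IsNormalizedLevels μ X τ u) ∧
  ∃ G Ghat : ℝ, 0 < G ∧ 0 < Ghat ∧ Ghat < 1 ∧ θ = (-Real.log G) / (-Real.log Ghat) ∧
    ∀ u : ℕ → ι → EReal, IsNormalizedLevels μ X τ u →
      Tendsto (fun n => maxProb μ X n (u n)) atTop (𝓝 G) ∧
      Tendsto (fun n => iidMaxProb μ X n (u n)) atTop (𝓝 Ghat)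

/-- A univariate series has extremal index `θ`, the same at every `τ > 0`. -/
def HasExtremalIndex (μ : Measure Ω) [IsProbabilityMeasure μ] (X : ℕ → Unit → Ω → ℝ) (θ : ℝ) :
    Prop :=
  ∀ s : ℝ, 0 < s → HasExtremalIndexAt μ X (fun _ => s) θ

/-- `r_j = E(T_{1j} ^ β_j)`. -/
def momentR (μ : Measure Ω) (T : ℕ → ι → Ω → ℝ) (β : ι → ℝ) (j : ι) : ℝ :=
  ∫ ω, T 0 j ω ^ β j ∂μ

/-- The standing assumptions on the factors: `Y` is stationary with Pareto-type coordinates,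
`T` is stationary with nonnegative coordinates, which have a moment of order larger than `β_j` and
do not vanish almost surely, and the two series are independent of each other. -/
structure IsModel (μ : Measure Ω) (Y T : ℕ → ι → Ω → ℝ) (β : ι → ℝ) : Prop where
  measurable_Y : ∀ n j, Measurable (Y n j)
  measurable_T : ∀ n j, Measurable (T n j)
  stationary_Y : IsStationary μ Y
  stationary_T : IsStationary μ T
  paretoType_Y : ∀ j, IsParetoType μ (Y 0 j) (β j)
  nonneg_T : ∀ n j, ∀ᵐ ω ∂μ, 0 ≤ T n j ω
  moment_T : ∀ j, ∃ ε : ℝ, β j < ε ∧ Integrable (fun ω => T 0 j ω ^ ε) μ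
  nonzero_T : ∀ j, ¬ (∀ᵐ ω ∂μ, T 0 j ω = 0)
  indep : IndepFun (fun ω (n : ℕ) (j : ι) => Y n j ω) (fun ω (n : ℕ) (j : ι) => T n j ω) μ

/-- The scale mixture `X_{nj} = Y_{nj} T_{nj}`. -/
def mix (Y T : ℕ → ι → Ω → ℝ) : ℕ → ι → Ω → ℝ := fun n j ω => Y n j ω * T n j ω

/-- The vectors `Y_1, …, Y_k` are (sequentially) tail independent:
`t * P(Y_{1j} > U_j(t), Y_{1+m,j'} > U_{j'}(t)) → 0` for all lags `1 ≤ m < k` and all `j`, `j'`. -/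
def IsTailIndependent (μ : Measure Ω) (Y : ℕ → ι → Ω → ℝ) (k : ℕ) : Prop :=
  ∀ m : ℕ, 1 ≤ m → m < k → ∀ j j' : ι,
    Tendsto (fun t : ℝ => t * μ.real (tailEvent μ Y t 0 j 1 ∩ tailEvent μ Y t m j' 1))
      atTop (𝓝 0)

/-- `∑_{∅ ≠ I ⊆ {1,…,k-1}} (-1)^(|I|+1) Λ_{(Y_1,…,Y_k)_{I ∪ {k}}} (x_{I ∪ {k}})`. -/
def clusterSum (μ : Measure Ω) (Y : ℕ → ι → Ω → ℝ) (k : ℕ) (x : ℕ → ι → ℝ) : ℝ :=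
  ∑ I ∈ (Finset.range (k - 1)).powerset.erase ∅,
    (-1) ^ (I.card + 1) * jointTail μ Y (insert (k - 1) I) x

/-- `∑_{∅ ⊆ I ⊆ {1,…,k-1}} (-1)^|I| Λ_{(Y_1,…,Y_k)_{I ∪ {k}}} (x_{I ∪ {k}})`. -/
def runSum (μ : Measure Ω) (Y : ℕ → ι → Ω → ℝ) (k : ℕ) (x : ℕ → ι → ℝ) : ℝ :=
  ∑ I ∈ (Finset.range (k - 1)).powerset,
    (-1) ^ I.card * jointTail μ Y (insert (k - 1) I) x

/-- `∑_{∅ ≠ I ⊆ {1,…,d}} (-1)^(|I|-1) Λ_{(Y_1)_I} (x_I)`. -/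
def unionSum [Fintype ι] [DecidableEq ι] (μ : Measure Ω) (Y : ℕ → ι → Ω → ℝ) (x : ι → ℝ) : ℝ :=
  ∑ I ∈ (Finset.univ : Finset ι).powerset.erase ∅,
    (-1) ^ (I.card - 1) * tailCopula μ Y I x

end ScaleMixture

end

namespace ScaleMixture

section Tails

variable {Ω : Type*} [MeasurableSpace Ω] {μ : Measure Ω} {Z : Ω → ℝ} {β ε : ℝ}

/-- The upper tail `v ↦ P(Z > v)`, for extended real levels. -/
noncomputable def upperTail (μ : Measure Ω) (Z : Ω → ℝ) (v : EReal) : ℝ :=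
  μ.real {ω | v < (Z ω : EReal)}

/-- The upper tail of `Z` is regularly varying with index `-β`. -/
def IsRegVar (μ : Measure Ω) (Z : Ω → ℝ) (β : ℝ) : Prop :=
  ∀ a : ℝ, 0 < a → Tendsto (fun x : ℝ => upperTail μ Z ((a * x : ℝ) : EReal) / upperTail μ Z x)
    atTop (𝓝 (a ^ (-β)))

lemma upperTail_nonneg (v : EReal) : 0 ≤ upperTail μ Z v := measureReal_nonneg

lemma upperTail_top : upperTail μ Z ⊤ = 0 := by
  simp [upperTail]

lemma upperTail_coe (x : ℝ) : upperTail μ Z x = μ.real {ω | x < Z ω} := by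
  simp [upperTail]

lemma upperTail_le_one [IsProbabilityMeasure μ] (v : EReal) : upperTail μ Z v ≤ 1 :=
  measureReal_le_one

lemma upperTail_antitone [IsProbabilityMeasure μ] : Antitone (upperTail μ Z) := fun _ _ h =>
  measureReal_mono fun _ hω => lt_of_le_of_lt h hω

lemma upperTail_mul_const {t : ℝ} (ht : 0 < t) (x : ℝ) :
    upperTail μ (fun ω => Z ω * t) x = upperTail μ Z ((t⁻¹ * x : ℝ) : EReal) := by
  simp only [upperTail_coe]
  congr 1
  ext ω
  simp only [Set.mem_ofPred_eq]
  rw [inv_mul_lt_iff₀ ht, mul_comm]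

lemma upperTail_mul_zero {x : ℝ} (hx : 0 ≤ x) : upperTail μ (fun ω => Z ω * 0) x = 0 := by
  simp [upperTail_coe, hx.not_gt]

lemma IsRegVar.pos [IsProbabilityMeasure μ] (h : IsRegVar μ Z β) (x : ℝ) : 0 < upperTail μ Z x := by
  have h1 := h 1 one_pos
  rw [Real.one_rpow] at h1
  obtain ⟨y, hy, hxy⟩ := ((h1.eventually_ne one_ne_zero).and (eventually_ge_atTop x)).exists
  have hy' : upperTail μ Z y ≠ 0 := fun h0 => hy (by simp [h0])
  exact ((upperTail_nonneg _).lt_of_ne' hy').trans_le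
    (upperTail_antitone (EReal.coe_le_coe_iff.2 hxy))

lemma tendsto_upperTail_atTop [IsProbabilityMeasure μ] (hZ : Measurable Z) :
    Tendsto (fun x : ℝ => upperTail μ Z x) atTop (𝓝 0) := by
  have : IsProbabilityMeasure (μ.map Z) := Measure.isProbabilityMeasure_map hZ.aemeasurable
  have h := (tendsto_cdf_atTop (μ.map Z)).const_sub 1
  rw [sub_self] at h
  refine h.congr fun x => ?_
  rw [cdf_eq_real, map_measureReal_apply hZ measurableSet_Iic, upperTail_coe,
    ← probReal_compl_eq_one_sub (hZ measurableSet_Iic)]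
  congr 1
  ext ω
  simp

lemma IsParetoType.isRegVar [IsProbabilityMeasure μ] (hZ : Measurable Z)
    (h : IsParetoType μ Z β) : IsRegVar μ Z β := by
  obtain ⟨-, l, hl, hF⟩ := h
  intro a ha
  have key : ∀ x : ℝ, 0 < x → upperTail μ Z x = x ^ (-β) * l x := fun x hx => by
    have h1 := hF x hx
    have h2 : {ω | x < Z ω} = {ω | Z ω ≤ x}ᶜ := by ext ω; simp
    rw [upperTail_coe, h2, probReal_compl_eq_one_sub (measurableSet_le hZ measurable_const), h1]
    ring
  have h3 := (hl a ha).const_mul (a ^ (-β))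
  rw [mul_one] at h3
  refine h3.congr' ?_
  filter_upwards [eventually_gt_atTop 0] with x hx
  rw [key x hx, key _ (mul_pos ha hx), Real.mul_rpow ha.le hx.le]
  have : x ^ (-β) ≠ 0 := (Real.rpow_pos_of_pos hx _).ne'
  rw [mul_assoc, mul_div_assoc, mul_div_mul_left _ _ this]

lemma IsRegVar.tendsto_scaled (h : IsRegVar μ Z β) (hβ : 0 < β) {t : ℝ} (ht : 0 ≤ t) :
    Tendsto (fun x : ℝ => upperTail μ (fun ω => Z ω * t) x / upperTail μ Z x) atTop
      (𝓝 (t ^ β)) := by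
  rcases ht.eq_or_lt with rfl | ht
  · rw [Real.zero_rpow hβ.ne']
    refine tendsto_const_nhds.congr' ?_
    filter_upwards [eventually_ge_atTop 0] with x hx
    rw [upperTail_mul_zero hx, zero_div]
  · have h1 := h t⁻¹ (inv_pos.2 ht)
    rw [Real.inv_rpow ht.le, Real.rpow_neg ht.le, inv_inv] at h1
    exact h1.congr fun x => by rw [upperTail_mul_const ht]

/-- A Potter bound for regularly varying tails. -/
lemma IsRegVar.exists_potter [IsProbabilityMeasure μ] (h : IsRegVar μ Z β) (hβ : 0 < β)
    (hε : β < ε) :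
    ∃ x₀ : ℝ, 0 < x₀ ∧ ∀ y : ℝ, x₀ ≤ y → ∀ c : ℝ, 1 ≤ c →
      upperTail μ Z y ≤ 2 ^ ε * c ^ ε * upperTail μ Z ((c * y : ℝ) : EReal) := by
  have h2 : (2 : ℝ) ^ (-ε) < 2 ^ (-β) :=
    Real.rpow_lt_rpow_of_exponent_lt one_lt_two (neg_lt_neg hε)
  obtain ⟨x₀, hx₀⟩ := eventually_atTop.1 ((h 2 two_pos).eventually (lt_mem_nhds h2))
  have step : ∀ y : ℝ, max x₀ 1 ≤ y →
      upperTail μ Z y ≤ 2 ^ ε * upperTail μ Z ((2 * y : ℝ) : EReal) := fun y hy => by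
    have h3 := hx₀ y ((le_max_left _ _).trans hy)
    rw [lt_div_iff₀ (h.pos y), Real.rpow_neg two_pos.le,
      inv_mul_lt_iff₀ (Real.rpow_pos_of_pos two_pos _)] at h3
    exact h3.le
  have iter : ∀ m : ℕ, ∀ y : ℝ, max x₀ 1 ≤ y →
      upperTail μ Z y ≤ (2 ^ ε) ^ m * upperTail μ Z ((2 ^ m * y : ℝ) : EReal) := fun m => by
    induction m with
    | zero => intro y _; simp
    | succ m ih =>
      intro y hy
      have hy0 : 0 ≤ y := zero_le_one.trans ((le_max_right _ _).trans hy)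
      refine (step y hy).trans ?_
      rw [pow_succ', mul_assoc]
      refine mul_le_mul_of_nonneg_left ?_ (Real.rpow_nonneg two_pos.le _)
      have h4 := ih (2 * y) (hy.trans (by linarith))
      rwa [← mul_assoc, ← pow_succ] at h4
  refine ⟨max x₀ 1, lt_max_of_lt_right one_pos, fun y hy c hc => ?_⟩
  have hy0 : 0 ≤ y := zero_le_one.trans ((le_max_right _ _).trans hy)
  obtain ⟨m, hm1, hm2⟩ := exists_nat_pow_near hc one_lt_two
  refine (iter (m + 1) y hy).trans ?_
  refine mul_le_mul ?_ ?_ (upperTail_nonneg _) ?_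
  · rw [pow_succ', Real.rpow_pow_comm two_pos.le]
    gcongr
    exact (hβ.trans hε).le
  · exact upperTail_antitone (EReal.coe_le_coe_iff.2 (mul_le_mul_of_nonneg_right hm2.le hy0))
  · have := zero_le_one.trans hc
    positivity

/-- The tails of the multiples `Z * t` are dominated by a multiple of the tail of `Z`. -/
lemma IsRegVar.exists_upperTail_mul_le [IsProbabilityMeasure μ] (h : IsRegVar μ Z β) (hβ : 0 < β)
    (hε : β < ε) :
    ∃ C x₀ : ℝ, 0 ≤ C ∧ ∀ v : EReal, (x₀ : EReal) ≤ v → ∀ t : ℝ, 0 ≤ t →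
      upperTail μ (fun ω => Z ω * t) v ≤ C * (1 + t ^ ε) * upperTail μ Z v := by
  obtain ⟨x₀, hx₀, hP⟩ := h.exists_potter hβ hε
  have hg₀ := h.pos x₀
  have h2 : (0 : ℝ) < 2 ^ ε := Real.rpow_pos_of_pos two_pos _
  refine ⟨1 + 2 ^ ε + 2 ^ ε / upperTail μ Z x₀, x₀, by positivity, fun v hv t ht => ?_⟩
  induction v with
  | bot => simp at hv
  | top => simp [upperTail_top]
  | coe x =>
    have hx : x₀ ≤ x := EReal.coe_le_coe_iff.1 hv
    have hgx := upperTail_nonneg (μ := μ) (Z := Z) x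
    have htε := Real.rpow_nonneg ht ε
    have hr : 0 ≤ 2 ^ ε / upperTail μ Z x₀ := by positivity
    rcases ht.eq_or_lt with rfl | ht
    · rw [upperTail_mul_zero (hx₀.le.trans hx)]
      positivity
    rw [upperTail_mul_const ht]
    rcases le_total t 1 with ht1 | ht1
    · have h3 : x ≤ t⁻¹ * x := le_mul_of_one_le_left (hx₀.le.trans hx) ((one_le_inv₀ ht).2 ht1)
      refine (upperTail_antitone (EReal.coe_le_coe_iff.2 h3)).trans ?_
      refine le_mul_of_one_le_left hgx ?_
      nlinarith
    · rcases le_total x₀ (t⁻¹ * x) with h3 | h3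
      · refine (hP _ h3 t ht1).trans ?_
        rw [mul_inv_cancel_left₀ ht.ne']
        gcongr
        · linarith
        · linarith
      · refine (upperTail_le_one _).trans ?_
        have h4 := hP x₀ le_rfl (x / x₀) ((one_le_div hx₀).2 hx)
        rw [div_mul_cancel₀ _ hx₀.ne'] at h4
        have h5 : x / x₀ ≤ t := by
          rw [inv_mul_le_iff₀ ht] at h3
          rwa [div_le_iff₀ hx₀]
        have h6 : (x / x₀) ^ ε ≤ t ^ ε :=
          Real.rpow_le_rpow (div_nonneg (hx₀.le.trans hx) hx₀.le) h5 (hβ.trans hε).le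
        have h7 : upperTail μ Z x₀ ≤ 2 ^ ε * t ^ ε * upperTail μ Z x := h4.trans (by gcongr)
        calc (1 : ℝ) = upperTail μ Z x₀ / upperTail μ Z x₀ := (div_self hg₀.ne').symm
          _ ≤ 2 ^ ε * t ^ ε * upperTail μ Z x / upperTail μ Z x₀ := by gcongr
          _ = 2 ^ ε / upperTail μ Z x₀ * t ^ ε * upperTail μ Z x := by ring
          _ ≤ _ := by
            gcongr
            · linarith
            · linarith

/-- Tail equivalence on the reals transfers to sequences of extended levels. -/
lemma tendsto_mul_of_tendsto_div {α : Type*} {l : Filter α} {f g : EReal → ℝ} (hf : f ⊤ = 0)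
    (hg : g ⊤ = 0) (hpos : ∀ x : ℝ, g x ≠ 0) {c σ : ℝ}
    (h : Tendsto (fun x : ℝ => f x / g x) atTop (𝓝 c)) {u : α → EReal} (hu : Tendsto u l (𝓝 ⊤))
    {w : α → ℝ} (hw : Tendsto (fun n => w n * g (u n)) l (𝓝 σ)) :
    Tendsto (fun n => w n * f (u n)) l (𝓝 (c * σ)) := by
  classical
  have hφ : Tendsto (fun v : EReal => if v = ⊤ then c else f v / g v) (𝓝 ⊤) (𝓝 c) := by
    rw [tendsto_def] at h ⊢
    intro s hs
    obtain ⟨y, hy⟩ := mem_atTop_sets.1 (h s hs)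
    refine EReal.mem_nhds_top_iff.2 ⟨y, fun v hv => ?_⟩
    induction v with
    | bot => simp at hv
    | top => simpa using mem_of_mem_nhds hs
    | coe x => simpa using hy x (EReal.coe_lt_coe_iff.1 hv).le
  refine ((hφ.comp hu).mul hw).congr' ?_
  filter_upwards [EReal.tendsto_nhds_top_iff_real.1 hu 0] with n hn
  simp only [Function.comp]
  generalize u n = v at hn ⊢
  induction v with
  | bot => simp at hn
  | top => simp [hf, hg]
  | coe x =>
    have := hpos x
    simp only [EReal.coe_ne_top, if_false]
    field_simp

lemma tendsto_top_of_upperTail [IsProbabilityMeasure μ] {α : Type*} {l : Filter α}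
    (h : IsRegVar μ Z β) {u : α → EReal} (hu : Tendsto (fun n => upperTail μ Z (u n)) l (𝓝 0)) :
    Tendsto u l (𝓝 ⊤) := by
  refine EReal.tendsto_nhds_top_iff_real.2 fun x => ?_
  filter_upwards [hu.eventually (gt_mem_nhds (h.pos x))] with n hn
  by_contra! h1
  exact absurd (upperTail_antitone (μ := μ) (Z := Z) h1) hn.not_ge

lemma tendsto_zero_of_nat_mul {f : ℕ → ℝ} {c : ℝ}
    (h : Tendsto (fun n : ℕ => (n : ℝ) * f n) atTop (𝓝 c)) : Tendsto f atTop (𝓝 0) := by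
  have h1 := h.mul tendsto_inv_atTop_nhds_zero_nat
  rw [mul_zero] at h1
  refine h1.congr' ?_
  filter_upwards [eventually_gt_atTop 0] with n hn
  have : (n : ℝ) ≠ 0 := by exact_mod_cast hn.ne'
  field_simp

section Quantile

variable [IsProbabilityMeasure μ]

lemma mem_tailQuantile_set (hZ : Measurable Z) {s : ℝ} (hs : 0 < s) (y : ℝ) :
    1 - (ENNReal.ofReal s)⁻¹ ≤ μ {ω | Z ω ≤ y} ↔ upperTail μ Z y ≤ s⁻¹ := by
  have h2 : {ω | y < Z ω} = {ω | Z ω ≤ y}ᶜ := by ext ω; simp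
  rw [upperTail_coe, h2, probReal_compl_eq_one_sub (measurableSet_le hZ measurable_const),
    ← ENNReal.ofReal_inv_of_pos hs, ← ENNReal.ofReal_one,
    ← ENNReal.ofReal_sub _ (inv_nonneg.2 hs.le), ← ofReal_measureReal (μ := μ),
    ENNReal.ofReal_le_ofReal_iff measureReal_nonneg]
  constructor <;> intro h <;> linarith

lemma lt_upperTail_of_lt_tailQuantile (hZ : Measurable Z) {s : ℝ} (hs : 0 < s) {y : ℝ}
    (hy : (y : EReal) < tailQuantile μ Z (ENNReal.ofReal s)) : s⁻¹ < upperTail μ Z y := by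
  by_contra! h
  exact hy.not_ge (sInf_le ⟨y, (mem_tailQuantile_set hZ hs y).2 h, rfl⟩)

lemma upperTail_tailQuantile_le (hZ : Measurable Z) {s : ℝ} (hs : 0 < s) :
    upperTail μ Z (tailQuantile μ Z (ENNReal.ofReal s)) ≤ s⁻¹ := by
  obtain ⟨y, hy⟩ : ∃ y : ℝ, upperTail μ Z y ≤ s⁻¹ :=
    (((tendsto_upperTail_atTop hZ).eventually (gt_mem_nhds (inv_pos.2 hs))).mono
      fun _ => le_of_lt).exists
  obtain ⟨u, hu, hlim, hmem⟩ := exists_seq_tendsto_sInf (α := EReal)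
    (S := (fun y : ℝ => (y : EReal)) '' {y : ℝ | 1 - (ENNReal.ofReal s)⁻¹ ≤ μ {ω | Z ω ≤ y}})
    ⟨y, y, (mem_tailQuantile_set hZ hs y).2 hy, rfl⟩ (OrderBot.bddBelow _)
  have h1 : {ω | tailQuantile μ Z (ENNReal.ofReal s) < (Z ω : EReal)} =
      ⋃ n, {ω | u n < (Z ω : EReal)} := by
    ext ω
    simp only [Set.mem_ofPred_eq, Set.mem_iUnion]
    constructor
    · intro h
      exact (hlim.eventually (gt_mem_nhds h)).exists
    · rintro ⟨n, hn⟩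
      exact (sInf_le (hmem n)).trans_lt hn
  have h2 : Tendsto (fun n => upperTail μ Z (u n)) atTop
      (𝓝 (upperTail μ Z (tailQuantile μ Z (ENNReal.ofReal s)))) := by
    unfold upperTail
    rw [h1]
    refine (ENNReal.tendsto_toReal (measure_ne_top μ _)).comp (tendsto_measure_iUnion_atTop ?_)
    exact fun m n hmn ω hω => (hu hmn).trans_lt hω
  refine le_of_tendsto' h2 fun n => ?_
  obtain ⟨z, hz, hzn⟩ := hmem n
  rw [← hzn]
  exact (mem_tailQuantile_set hZ hs z).1 hz

lemma tailQuantile_top (h : IsRegVar μ Z β) (hZ : Measurable Z) : tailQuantile μ Z ⊤ = ⊤ := by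
  unfold tailQuantile
  have : {y : ℝ | 1 - (⊤ : ℝ≥0∞)⁻¹ ≤ μ {ω | Z ω ≤ y}} = ∅ := by
    refine Set.eq_empty_iff_forall_notMem.2 fun y hy => ?_
    simp only [ENNReal.inv_top, tsub_zero, Set.mem_ofPred_eq] at hy
    have h2 : {ω | y < Z ω} = {ω | Z ω ≤ y}ᶜ := by ext ω; simp
    have h3 := h.pos y
    rw [upperTail_coe, h2, measureReal_def,
      (prob_compl_eq_zero_iff (measurableSet_le hZ measurable_const)).2 (prob_le_one.antisymm hy)]
      at h3
    simp at h3
  rw [this]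
  simp

lemma tendsto_tailQuantile (h : IsRegVar μ Z β) (hZ : Measurable Z) :
    Tendsto (fun s : ℝ => tailQuantile μ Z (ENNReal.ofReal s)) atTop (𝓝 ⊤) := by
  refine tendsto_top_of_upperTail h (squeeze_zero' (.of_forall fun _ => upperTail_nonneg _) ?_
    tendsto_inv_atTop_zero)
  filter_upwards [eventually_gt_atTop 0] with s hs using upperTail_tailQuantile_le hZ hs

lemma tailQuantile_ne_top (hZ : Measurable Z) {s : ℝ} (hs : 0 < s) :
    tailQuantile μ Z (ENNReal.ofReal s) ≠ ⊤ := by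
  intro htop
  obtain ⟨y, hy⟩ : ∃ y : ℝ, upperTail μ Z y < s⁻¹ :=
    ((tendsto_upperTail_atTop hZ).eventually (gt_mem_nhds (inv_pos.2 hs))).exists
  exact absurd (lt_upperTail_of_lt_tailQuantile (μ := μ) (y := y) hZ hs
    (by rw [htop]; exact EReal.coe_lt_top y)) hy.not_gt

lemma tendsto_mul_upperTail_tailQuantile (h : IsRegVar μ Z β) (hZ : Measurable Z) :
    Tendsto (fun s : ℝ => s * upperTail μ Z (tailQuantile μ Z (ENNReal.ofReal s))) atTop
      (𝓝 1) := by
  refine tendsto_order.2 ⟨fun c hc => ?_, fun c hc => ?_⟩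
  · rcases le_or_gt c 0 with hc0 | hc0
    · have hq := tendsto_tailQuantile h hZ
      filter_upwards [eventually_gt_atTop 0] with s hs
      refine hc0.trans_lt (mul_pos hs ?_)
      have h1 := tailQuantile_ne_top (μ := μ) hZ hs
      generalize tailQuantile μ Z (ENNReal.ofReal s) = v at h1
      induction v with
      | top => exact absurd rfl h1
      | bot => exact (h.pos 0).trans_le (upperTail_antitone bot_le)
      | coe x => exact h.pos x
    · have hcont : ContinuousAt (fun a : ℝ => a ^ (-β)) 1 :=
        Real.continuousAt_rpow_const _ _ (Or.inl one_ne_zero)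
      have hc1 : (1 : ℝ) ^ (-β) < c⁻¹ := by
        rw [Real.one_rpow]; exact (one_lt_inv₀ hc0).2 hc
      obtain ⟨a, ⟨ha, ha0⟩, ha1⟩ := (((hcont.eventually (gt_mem_nhds hc1)).and
        (lt_mem_nhds (show (0 : ℝ) < 1 from one_pos))).filter_mono
        (nhdsWithin_le_nhds (s := Set.Iio 1))|>.and self_mem_nhdsWithin).exists
      obtain ⟨x₀, hx₀⟩ := eventually_atTop.1 ((h a ha0).eventually (gt_mem_nhds ha))
      filter_upwards [eventually_gt_atTop 0, EReal.tendsto_nhds_top_iff_real.1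
        (tendsto_tailQuantile h hZ) (max x₀ 0)] with s hs hsx
      have h1 := tailQuantile_ne_top (μ := μ) hZ hs
      have h2 := fun y => lt_upperTail_of_lt_tailQuantile (μ := μ) (y := y) hZ hs
      generalize tailQuantile μ Z (ENNReal.ofReal s) = v at h1 h2 hsx ⊢
      induction v with
      | top => exact absurd rfl h1
      | bot => simp at hsx
      | coe x =>
        have hx := EReal.coe_lt_coe_iff.1 hsx
        have hx0 : 0 < x := (le_max_right _ _).trans_lt hx
        have h3 := h2 (a * x) (EReal.coe_lt_coe_iff.2 (mul_lt_of_lt_one_left hx0 ha1))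
        have h4 := hx₀ x ((le_max_left _ _).trans hx.le)
        rw [div_lt_iff₀ (h.pos x)] at h4
        have h5 := h3.trans h4
        rw [inv_mul_eq_div, lt_div_iff₀ hc0] at h5
        rwa [inv_mul_lt_iff₀ hs] at h5
  · filter_upwards [eventually_gt_atTop 0] with s hs
    refine lt_of_le_of_lt ?_ hc
    calc s * _ ≤ s * s⁻¹ := mul_le_mul_of_nonneg_left (upperTail_tailQuantile_le hZ hs) hs.le
      _ = 1 := mul_inv_cancel₀ hs.ne'

lemma tendsto_mul_upperTail_tailQuantile_div (h : IsRegVar μ Z β) (hZ : Measurable Z) {x : ℝ}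
    (hx : 0 ≤ x) :
    Tendsto (fun t : ℝ => t * upperTail μ Z
      (tailQuantile μ Z (ENNReal.ofReal t / ENNReal.ofReal x))) atTop (𝓝 x) := by
  rcases hx.eq_or_lt with rfl | hx
  · refine tendsto_const_nhds.congr' ?_
    filter_upwards [eventually_gt_atTop 0] with t ht
    rw [ENNReal.ofReal_zero, ENNReal.div_zero (by simpa using ht), tailQuantile_top h hZ,
      upperTail_top, mul_zero]
  · have h1 := ((tendsto_mul_upperTail_tailQuantile h hZ).comp
      (tendsto_id.atTop_div_const hx)).const_mul x
    rw [mul_one] at h1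
    refine h1.congr fun t => ?_
    simp only [Function.comp, id, ENNReal.ofReal_div_of_pos hx]
    field_simp

end Quantile

end Tails

section Independence

variable {Ω E F : Type*} [MeasurableSpace Ω] [MeasurableSpace E] [MeasurableSpace F]
  {μ : Measure Ω} [IsProbabilityMeasure μ]

lemma measurable_measureReal_section {f : Ω → E} {g : Ω → F} (hf : Measurable f)
    (hg : Measurable g) {B : Set (E × F)} (hB : MeasurableSet B) :
    Measurable fun ω => μ.real {ω' | (f ω', g ω) ∈ B} := by
  have : IsProbabilityMeasure (μ.map f) := Measure.isProbabilityMeasure_map hf.aemeasurable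
  have h := ((measurable_measure_prodMk_right (μ := μ.map f) hB).comp hg).ennreal_toReal
  convert h using 2 with ω
  simp only [Function.comp]
  rw [Measure.map_apply hf (measurable_prodMk_right hB)]
  rfl

lemma measureReal_eq_integral_section {f : Ω → E} {g : Ω → F} (hf : Measurable f)
    (hg : Measurable g) (h : IndepFun f g μ) {B : Set (E × F)} (hB : MeasurableSet B) :
    μ.real {ω | (f ω, g ω) ∈ B} = ∫ ω, μ.real {ω' | (f ω', g ω) ∈ B} ∂μ := by
  have : IsProbabilityMeasure (μ.map f) := Measure.isProbabilityMeasure_map hf.aemeasurable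
  have : IsProbabilityMeasure (μ.map g) := Measure.isProbabilityMeasure_map hg.aemeasurable
  have h1 := (indepFun_iff_map_prod_eq_prod_map_map hf.aemeasurable hg.aemeasurable).1 h
  have h2 : μ {ω | (f ω, g ω) ∈ B} = ∫⁻ ω, μ {ω' | (f ω', g ω) ∈ B} ∂μ := by
    have h3 : μ {ω | (f ω, g ω) ∈ B} = μ.map (fun ω => (f ω, g ω)) B :=
      (Measure.map_apply (hf.prodMk hg) hB).symm
    rw [h3, h1, Measure.prod_apply_symm hB, lintegral_map (measurable_measure_prodMk_right hB) hg]
    refine lintegral_congr fun ω => ?_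
    rw [Measure.map_apply hf (measurable_prodMk_right hB)]
    rfl
  rw [measureReal_def, h2, ← integral_toReal]
  · rfl
  · have h4 := measurable_measureReal_section (μ := μ) hf hg hB
    refine Measurable.aemeasurable ?_
    convert h4.ennreal_ofReal using 2 with ω
    rw [ofReal_measureReal]
  · exact .of_forall fun ω => measure_lt_top _ _

/-- Dominated convergence, together with the integrability of the limit. -/
lemma integrable_and_tendsto_integral {Ω : Type*} [MeasurableSpace Ω] {μ : Measure Ω}
    {F : ℕ → Ω → ℝ} {f bound : Ω → ℝ}
    (hF : ∀ n, AEStronglyMeasurable (F n) μ)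
    (hb : ∀ᶠ n in atTop, ∀ᵐ ω ∂μ, |F n ω| ≤ bound ω) (hbi : Integrable bound μ)
    (hlim : ∀ᵐ ω ∂μ, Tendsto (fun n => F n ω) atTop (𝓝 (f ω))) :
    Integrable f μ ∧ Tendsto (fun n => ∫ ω, F n ω ∂μ) atTop (𝓝 (∫ ω, f ω ∂μ)) := by
  refine ⟨hbi.mono' (aestronglyMeasurable_of_tendsto_ae atTop hF hlim) ?_,
    tendsto_integral_filter_of_dominated_convergence bound (.of_forall hF) hb hbi hlim⟩
  obtain ⟨N, hN⟩ := eventually_atTop.1 hb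
  have h1 : ∀ᵐ ω ∂μ, ∀ n, N ≤ n → |F n ω| ≤ bound ω :=
    ae_all_iff.2 fun n => by
      by_cases hn : N ≤ n
      · exact (hN n hn).mono fun _ h _ => h
      · exact .of_forall fun _ h => absurd h hn
  filter_upwards [hlim, h1] with ω h2 h3
  exact le_of_tendsto h2.norm (eventually_atTop.2 ⟨N, h3⟩)

end Independence

section Breiman

variable {Ω : Type*} [MeasurableSpace Ω] {μ : Measure Ω} [IsProbabilityMeasure μ] {Z W : Ω → ℝ}
  {β ε : ℝ}

lemma integrable_rpow_of_lt (hW : Measurable W) (hW0 : ∀ᵐ ω ∂μ, 0 ≤ W ω) (hβ : 0 < β) (hε : β < ε)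
    (hint : Integrable (fun ω => W ω ^ ε) μ) : Integrable (fun ω => W ω ^ β) μ := by
  refine ((integrable_const (1 : ℝ)).add hint).mono' (hW.pow_const β).aestronglyMeasurable ?_
  filter_upwards [hW0] with ω hω
  rw [Real.norm_of_nonneg (Real.rpow_nonneg hω _), Pi.add_apply]
  rcases le_total (W ω) 1 with h1 | h1
  · have := Real.rpow_le_one hω h1 hβ.le
    have := Real.rpow_nonneg hω ε
    linarith
  · have := Real.rpow_le_rpow_of_exponent_le h1 hε.le
    linarith

lemma integral_rpow_pos (hW : Measurable W) (hW0 : ∀ᵐ ω ∂μ, 0 ≤ W ω)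
    (hne : ¬ ∀ᵐ ω ∂μ, W ω = 0) (hβ : 0 < β) (hε : β < ε)
    (hint : Integrable (fun ω => W ω ^ ε) μ) : 0 < ∫ ω, W ω ^ β ∂μ := by
  have h0 : 0 ≤ᵐ[μ] fun ω => W ω ^ β := by
    filter_upwards [hW0] with ω hω using Real.rpow_nonneg hω _
  refine (integral_nonneg_of_ae h0).lt_of_ne' fun h => hne ?_
  rw [integral_eq_zero_iff_of_nonneg_ae h0 (integrable_rpow_of_lt hW hW0 hβ hε hint)] at h
  filter_upwards [h, hW0] with ω h1 h2
  exact (Real.rpow_eq_zero h2 hβ.ne').1 h1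

/-- **Breiman's lemma**. -/
lemma IsRegVar.tendsto_breiman (h : IsRegVar μ Z β) (hZ : Measurable Z) (hW : Measurable W)
    (hind : IndepFun Z W μ) (hβ : 0 < β) (hε : β < ε) (hW0 : ∀ᵐ ω ∂μ, 0 ≤ W ω)
    (hint : Integrable (fun ω => W ω ^ ε) μ) :
    Tendsto (fun x : ℝ => upperTail μ (fun ω => Z ω * W ω) x / upperTail μ Z x) atTop
      (𝓝 (∫ ω, W ω ^ β ∂μ)) := by
  have hB : ∀ x : ℝ, MeasurableSet {p : ℝ × ℝ | x < p.1 * p.2} := fun x =>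
    measurableSet_lt measurable_const (measurable_fst.mul measurable_snd)
  have h1 : ∀ x : ℝ, upperTail μ (fun ω => Z ω * W ω) x / upperTail μ Z x =
      ∫ ω, upperTail μ (fun ω' => Z ω' * W ω) x / upperTail μ Z x ∂μ := fun x => by
    rw [integral_div]
    simp only [upperTail_coe]
    exact congrArg (· / _) (measureReal_eq_integral_section hZ hW hind (hB x))
  simp only [h1]
  obtain ⟨C, x₀, hC, hdom⟩ := h.exists_upperTail_mul_le hβ hε
  refine tendsto_integral_filter_of_dominated_convergence (fun ω => C * (1 + W ω ^ ε)) ?_ ?_ ?_ ?_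
  · refine .of_forall fun x => Measurable.aestronglyMeasurable ?_
    refine Measurable.div_const ?_ _
    simp only [upperTail_coe]
    exact measurable_measureReal_section hZ hW (hB x)
  · filter_upwards [eventually_ge_atTop x₀] with x hx
    filter_upwards [hW0] with ω hω
    rw [Real.norm_of_nonneg (div_nonneg (upperTail_nonneg _) (upperTail_nonneg _)),
      div_le_iff₀ (h.pos x)]
    exact hdom x (EReal.coe_le_coe_iff.2 hx) _ hω
  · exact ((integrable_const 1).add hint).const_mul C
  · filter_upwards [hW0] with ω hω using h.tendsto_scaled hβ hω

lemma IsRegVar.mul (h : IsRegVar μ Z β) (hZ : Measurable Z) (hW : Measurable W)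
    (hind : IndepFun Z W μ) (hβ : 0 < β) (hε : β < ε) (hW0 : ∀ᵐ ω ∂μ, 0 ≤ W ω)
    (hne : ¬ ∀ᵐ ω ∂μ, W ω = 0) (hint : Integrable (fun ω => W ω ^ ε) μ) :
    IsRegVar μ (fun ω => Z ω * W ω) β := by
  intro a ha
  have hr := integral_rpow_pos hW hW0 hne hβ hε hint
  have h1 := h.tendsto_breiman hZ hW hind hβ hε hW0 hint
  have h2 := ((h1.comp (tendsto_id.const_mul_atTop ha)).mul (h a ha)).mul (h1.inv₀ hr.ne')
  rw [mul_right_comm, mul_inv_cancel₀ hr.ne', one_mul] at h2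
  refine h2.congr fun x => ?_
  have h3 := (h.pos x).ne'
  have h4 := (h.pos (a * x)).ne'
  simp only [Function.comp, id, inv_div]
  field_simp

end Breiman

section Stationary

variable {Ω ι : Type*} [MeasurableSpace Ω] {μ : Measure Ω} {X : ℕ → ι → Ω → ℝ}

/-- The path `n ↦ X n` of a series. -/
def path (X : ℕ → ι → Ω → ℝ) (ω : Ω) : ℕ → ι → ℝ := fun n j => X n j ω

lemma measurable_path (hX : ∀ n j, Measurable (X n j)) : Measurable (path X) :=
  measurable_pi_lambda _ fun n => measurable_pi_lambda _ fun j => hX n j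

lemma measurable_shift (m : ℕ) : Measurable fun (x : ℕ → ι → ℝ) (n : ℕ) => x (n + m) :=
  measurable_pi_lambda _ fun n => measurable_pi_apply (n + m)

lemma IsStationary.measureReal_shift (h : IsStationary μ X) (hX : ∀ n j, Measurable (X n j))
    (m : ℕ) {B : Set (ℕ → ι → ℝ)} (hB : MeasurableSet B) :
    μ.real {ω | (fun n => path X ω (n + m)) ∈ B} = μ.real {ω | path X ω ∈ B} := by
  induction m with
  | zero => rfl
  | succ m ih =>
    rw [← ih]
    have h1 := congrArg (fun ν => Measure.real ν
        ((fun (x : ℕ → ι → ℝ) (n : ℕ) => x (n + m)) ⁻¹' B)) h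
    change Measure.real (μ.map (path X)) _ = Measure.real
        (μ.map (path fun n j => X (n + 1) j)) _ at h1
    rw [map_measureReal_apply (measurable_path hX) (measurable_shift m hB),
      map_measureReal_apply (measurable_path (X := fun n j => X (n + 1) j) fun n j => hX _ _)
        (measurable_shift m hB)] at h1
    refine Eq.trans ?_ h1.symm
    congr 1

lemma measurable_coord (n : ℕ) (j : ι) : Measurable fun x : ℕ → ι → ℝ => x n j :=
  (measurable_pi_apply j).comp (measurable_pi_apply n)

lemma measurable_mul_series : Measurable fun p : (ℕ → ι → ℝ) × (ℕ → ι → ℝ) => p.1 * p.2 := by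
  refine measurable_pi_lambda _ fun n => measurable_pi_lambda _ fun j => ?_
  exact ((measurable_coord n j).comp measurable_fst).mul
      ((measurable_coord n j).comp measurable_snd)

variable {Y T : ℕ → ι → Ω → ℝ} {β : ι → ℝ}

lemma IsModel.measurable_mix (h : IsModel μ Y T β) (n : ℕ) (j : ι) : Measurable (mix Y T n j) :=
  (h.measurable_Y n j).mul (h.measurable_T n j)

lemma IsModel.beta_pos (h : IsModel μ Y T β) (j : ι) : 0 < β j := (h.paretoType_Y j).1

lemma IsModel.indep_zero (h : IsModel μ Y T β) (j : ι) : IndepFun (Y 0 j) (T 0 j) μ := by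
  exact h.indep.comp (measurable_coord 0 j) (measurable_coord 0 j)

variable [IsProbabilityMeasure μ]

lemma IsModel.stationary_mix (h : IsModel μ Y T β) : IsStationary μ (mix Y T) := by
  have hY := measurable_path h.measurable_Y
  have hT := measurable_path h.measurable_T
  have hY' := (measurable_shift (ι := ι) 1).comp hY
  have hT' := (measurable_shift (ι := ι) 1).comp hT
  have h1 := (indepFun_iff_map_prod_eq_prod_map_map hY.aemeasurable hT.aemeasurable).1 h.indep
  have h2 := (indepFun_iff_map_prod_eq_prod_map_map hY'.aemeasurable hT'.aemeasurable).1
    (h.indep.comp (measurable_shift 1) (measurable_shift 1))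
  have h3 : μ.map (fun ω => (path Y ω, path T ω)) =
      μ.map (fun ω => (((fun (x : ℕ → ι → ℝ) (n : ℕ) => x (n + 1)) ∘ path Y) ω,
        ((fun (x : ℕ → ι → ℝ) (n : ℕ) => x (n + 1)) ∘ path T) ω)) := by
    rw [h1, h2]
    congr 1
    · exact h.stationary_Y
    · exact h.stationary_T
  have h4 := congrArg (Measure.map fun p : (ℕ → ι → ℝ) × (ℕ → ι → ℝ) => p.1 * p.2) h3
  rw [Measure.map_map measurable_mul_series (hY.prodMk hT),
    Measure.map_map measurable_mul_series (hY'.prodMk hT')] at h4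
  exact h4

lemma IsModel.isRegVar (h : IsModel μ Y T β) (j : ι) : IsRegVar μ (Y 0 j) (β j) :=
  (h.paretoType_Y j).isRegVar (h.measurable_Y 0 j)

lemma IsModel.isRegVar_mix (h : IsModel μ Y T β) (j : ι) : IsRegVar μ (mix Y T 0 j) (β j) := by
  obtain ⟨ε, hε, hint⟩ := h.moment_T j
  exact (h.isRegVar j).mul (h.measurable_Y 0 j) (h.measurable_T 0 j) (h.indep_zero j)
    (h.beta_pos j) hε (h.nonneg_T 0 j) (h.nonzero_T j) hint

lemma IsModel.momentR_pos (h : IsModel μ Y T β) (j : ι) : 0 < momentR μ T β j := by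
  obtain ⟨ε, hε, hint⟩ := h.moment_T j
  exact integral_rpow_pos (h.measurable_T 0 j) (h.nonneg_T 0 j) (h.nonzero_T j) (h.beta_pos j) hε
    hint

lemma IsModel.tendsto_breiman (h : IsModel μ Y T β) (j : ι) :
    Tendsto (fun x : ℝ => upperTail μ (mix Y T 0 j) x / upperTail μ (Y 0 j) x) atTop
      (𝓝 (momentR μ T β j)) := by
  obtain ⟨ε, hε, hint⟩ := h.moment_T j
  exact (h.isRegVar j).tendsto_breiman (h.measurable_Y 0 j) (h.measurable_T 0 j) (h.indep_zero j)
    (h.beta_pos j) hε (h.nonneg_T 0 j) hint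

lemma IsModel.integrable_rpow (h : IsModel μ Y T β) {j : ι} {ε : ℝ}
    (hint : Integrable (fun ω => T 0 j ω ^ ε) μ) (i : ℕ) :
    Integrable (fun ω => T i j ω ^ ε) μ := by
  have hid : μ.map (T i j) = μ.map (T 0 j) := by
    refine Measure.ext fun B hB => ?_
    have h1 := h.stationary_T.measureReal_shift h.measurable_T i (measurable_coord 0 j hB)
    rw [Measure.map_apply (h.measurable_T i j) hB, Measure.map_apply (h.measurable_T 0 j) hB,
      ← ENNReal.toReal_eq_toReal_iff' (measure_ne_top _ _) (measure_ne_top _ _)]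
    simp only [path, zero_add, Set.mem_preimage] at h1
    exact h1
  have hm : AEStronglyMeasurable (fun x : ℝ => x ^ ε) (μ.map (T 0 j)) :=
    (measurable_id.pow_const ε).aestronglyMeasurable
  have h2 := (integrable_map_measure hm (h.measurable_T 0 j).aemeasurable).2 hint
  rw [← hid] at h2 hm
  exact (integrable_map_measure hm (h.measurable_T i j).aemeasurable).1 h2

end Stationary

section Extremal

variable {Ω ι : Type*}

/-- No vector of the series exceeds `v` at the times `i` with `a ≤ i < b`. -/
def noExceed (X : ℕ → ι → Ω → ℝ) (v : ι → EReal) (a b : ℕ) : Set Ω :=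
  {ω | ∀ i, a ≤ i → i < b → ω ∈ belowEvent X i v}

/-- The event that the first vector exceeds `v` and the next `m` vectors do not. -/
def runEnd (X : ℕ → ι → Ω → ℝ) (v : ι → EReal) (m : ℕ) : Set Ω :=
  (belowEvent X 0 v)ᶜ ∩ noExceed X v 1 (m + 1)

variable {X : ℕ → ι → Ω → ℝ} {v : ι → EReal}

lemma noExceed_inter (a b c : ℕ) (hab : a ≤ b) (hbc : b ≤ c) :
    noExceed X v a b ∩ noExceed X v b c = noExceed X v a c := by
  ext ω
  constructor
  · rintro ⟨h1, h2⟩ i hai hic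
    rcases lt_or_ge i b with h | h
    · exact h1 i hai h
    · exact h2 i h hic
  · exact fun h => ⟨fun i h1 h2 => h i h1 (h2.trans_le hbc), fun i h1 h2 => h i (hab.trans h1) h2⟩

lemma noExceed_anti {a b c : ℕ} (hbc : b ≤ c) : noExceed X v a c ⊆ noExceed X v a b :=
  fun _ h i h1 h2 => h i h1 (h2.trans_le hbc)

lemma noExceed_eq_biInter (a b : ℕ) :
    noExceed X v a b = ⋂ i ∈ Finset.Ico a b, belowEvent X i v := by
  ext ω
  simp [noExceed]

lemma measurableSet_belowEvent' [Countable ι] {m : MeasurableSpace Ω} {i : ℕ}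
    (hX : ∀ j, Measurable[m] (X i j)) : MeasurableSet[m] (belowEvent X i v) := by
  have : belowEvent X i v = ⋂ j, {ω | (X i j ω : EReal) ≤ v j} := by
    ext ω
    simp [belowEvent]
  rw [this]
  exact MeasurableSet.iInter fun j =>
    (measurable_coe_real_ereal.comp (hX j)) measurableSet_Iic

lemma measurableSet_noExceed' [Countable ι] {m : MeasurableSpace Ω} {a b : ℕ}
    (hX : ∀ i, a ≤ i → i < b → ∀ j, Measurable[m] (X i j)) :
    MeasurableSet[m] (noExceed X v a b) := by
  rw [noExceed_eq_biInter]
  refine Finset.measurableSet_biInter _ fun i hi => measurableSet_belowEvent' fun j => ?_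
  rw [Finset.mem_Ico] at hi
  exact hX i hi.1 hi.2 j

lemma measurable_of_mem {s : Set ℕ} {i : ℕ} (hi : i ∈ s) (j : ι) :
    Measurable[⨆ i ∈ s, ⨆ j, MeasurableSpace.comap (X i j) inferInstance] (X i j) := by
  have h : MeasurableSpace.comap (X i j) inferInstance ≤
      ⨆ i ∈ s, ⨆ j, MeasurableSpace.comap (X i j) inferInstance :=
    (le_iSup (fun j => MeasurableSpace.comap (X i j) inferInstance) j).trans
      (le_iSup₂ (f := fun i (_ : i ∈ s) => ⨆ j, MeasurableSpace.comap (X i j) inferInstance) i hi)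
  exact (comap_measurable (X i j)).mono h le_rfl

variable [MeasurableSpace Ω] {μ : Measure Ω}

lemma maxProb_eq (n : ℕ) (v : ι → EReal) : maxProb μ X n v = μ.real (noExceed X v 0 n) := by
  unfold maxProb noExceed compMax belowEvent
  congr 1
  ext ω
  simp only [Set.mem_ofPred_eq, Finset.sup_le_iff, Finset.mem_range, zero_le, true_implies]
  exact ⟨fun h i hi j => h j i hi, fun h j i hi => h i hi j⟩

lemma measurableSet_belowEvent [Countable ι] (hX : ∀ n j, Measurable (X n j)) (i : ℕ)
    (v : ι → EReal) :
    MeasurableSet (belowEvent X i v) :=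
  measurableSet_belowEvent' (hX i)

lemma measurableSet_noExceed [Countable ι] (hX : ∀ n j, Measurable (X n j)) (v : ι → EReal)
    (a b : ℕ) :
    MeasurableSet (noExceed X v a b) :=
  measurableSet_noExceed' fun i _ _ => hX i

lemma measureReal_noExceed_shift [Countable ι] (hs : IsStationary μ X)
    (hX : ∀ n j, Measurable (X n j))
    (v : ι → EReal) (a b m : ℕ) :
    μ.real (noExceed X v (a + m) (b + m)) = μ.real (noExceed X v a b) := by
  have hB : MeasurableSet (noExceed (fun n j (x : ℕ → ι → ℝ) => x n j) v a b) :=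
    measurableSet_noExceed measurable_coord v a b
  refine Eq.trans ?_ (hs.measureReal_shift hX m hB)
  congr 1
  ext ω
  constructor
  · exact fun h i h1 h2 => h (i + m) (by omega) (by omega)
  · intro h i h1 h2
    have := h (i - m) (by omega) (by omega)
    simpa [belowEvent, path, Nat.sub_add_cancel (show m ≤ i by omega)] using this

variable [IsProbabilityMeasure μ]

lemma mixingCoeff_set_bddAbove (s : ℕ) : BddAbove {a : ℝ | ∃ (p : ℕ) (A B : Set Ω),
    MeasurableSet[⨆ i ∈ Set.Iic p, ⨆ j, MeasurableSpace.comap (X i j) inferInstance] A ∧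
    MeasurableSet[⨆ i ∈ Set.Ici (p + s), ⨆ j, MeasurableSpace.comap (X i j) inferInstance] B ∧
    a = |μ.real (A ∩ B) - μ.real A * μ.real B|} := by
  refine ⟨1, ?_⟩
  rintro _ ⟨p, A, B, -, -, rfl⟩
  have h1 : μ.real (A ∩ B) ≤ 1 := measureReal_le_one
  have h2 : μ.real A * μ.real B ≤ 1 :=
    mul_le_one₀ measureReal_le_one measureReal_nonneg measureReal_le_one
  have h3 : 0 ≤ μ.real (A ∩ B) := measureReal_nonneg
  have h4 : 0 ≤ μ.real A * μ.real B := mul_nonneg measureReal_nonneg measureReal_nonneg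
  rw [abs_le]
  constructor <;> linarith

lemma mixingCoeff_nonneg (s : ℕ) : 0 ≤ mixingCoeff μ X s := by
  refine le_csSup (mixingCoeff_set_bddAbove s) ⟨0, ∅, ∅, ?_, ?_, ?_⟩
  · exact @MeasurableSet.empty _ (_)
  · exact @MeasurableSet.empty _ (_)
  · simp

lemma abs_runEnd_sub_le {k : ℕ} (hk : 2 ≤ k) (v : ι → EReal) {m r : ℕ} (hm : m < r) :
    |μ.real (runEnd X v m) - μ.real (runEnd X v (k - 1))| ≤
      (if m < k then μ.real (belowEvent X 0 v)ᶜ else 0) + ∑ i ∈ Finset.Icc k r,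
        μ.real ((belowEvent X 0 v)ᶜ ∩ belowEvent X (i - 1) v ∩ (belowEvent X i v)ᶜ) := by
  have hsum : 0 ≤ ∑ i ∈ Finset.Icc k r,
      μ.real ((belowEvent X 0 v)ᶜ ∩ belowEvent X (i - 1) v ∩ (belowEvent X i v)ᶜ) :=
    Finset.sum_nonneg fun _ _ => measureReal_nonneg
  split_ifs with h
  · refine le_add_of_le_of_nonneg ?_ hsum
    have h1 : ∀ m, μ.real (runEnd X v m) ≤ μ.real (belowEvent X 0 v)ᶜ := fun m =>
      measureReal_mono Set.inter_subset_left
    exact abs_sub_le_of_nonneg_of_le measureReal_nonneg (h1 _) measureReal_nonneg (h1 _)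
  · rw [zero_add, abs_sub_comm, abs_of_nonneg]
    · have h1 : runEnd X v (k - 1) ⊆ runEnd X v m ∪ ⋃ i ∈ Finset.Icc k r,
          ((belowEvent X 0 v)ᶜ ∩ belowEvent X (i - 1) v ∩ (belowEvent X i v)ᶜ) := by
        rintro ω ⟨h0, hω⟩
        by_cases hR : ω ∈ noExceed X v 1 (m + 1)
        · exact Or.inl ⟨h0, hR⟩
        right
        classical
        have hex : ∃ i, 1 ≤ i ∧ i < m + 1 ∧ ω ∉ belowEvent X i v := by
          simpa [noExceed] using hR
        obtain ⟨h2, h3, h4⟩ := Nat.find_spec hex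
        have hmin := fun i => Nat.find_min hex (m := i)
        generalize Nat.find hex = i at h2 h3 h4 hmin
        have hki : k ≤ i := by
          by_contra! hlt
          exact h4 (hω i h2 (by omega))
        simp only [Set.mem_iUnion, Finset.mem_Icc]
        refine ⟨i, ⟨hki, by omega⟩, ⟨h0, ?_⟩, h4⟩
        by_contra h5
        exact hmin (i - 1) (by omega) ⟨by omega, by omega, h5⟩
      have h2 := (measureReal_mono h1 (μ := μ)).trans (measureReal_union_le _ _)
      have h3 := measureReal_biUnion_finset_le (μ := μ) (Finset.Icc k r) fun i =>
        (belowEvent X 0 v)ᶜ ∩ belowEvent X (i - 1) v ∩ (belowEvent X i v)ᶜ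
      linarith
    · refine sub_nonneg.2 (measureReal_mono ?_)
      exact Set.inter_subset_inter_right _ (noExceed_anti (by omega))

variable [Countable ι]

lemma measureReal_belowEvent_compl (hs : IsStationary μ X) (hX : ∀ n j, Measurable (X n j))
    (v : ι → EReal) (i : ℕ) :
    μ.real (belowEvent X i v)ᶜ = μ.real (belowEvent X 0 v)ᶜ := by
  have h1 : ∀ i, belowEvent X i v = noExceed X v i (i + 1) := fun i => by
    rw [noExceed_eq_biInter]; simp
  have h2 := measureReal_noExceed_shift hs hX v 0 1 i
  rw [probReal_compl_eq_one_sub (measurableSet_belowEvent hX i v),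
    probReal_compl_eq_one_sub (measurableSet_belowEvent hX 0 v), h1 i, h1 0, ← h2]
  simp [add_comm]

lemma measureReal_noExceed_inter_le (hs : IsStationary μ X) (hX : ∀ n j, Measurable (X n j))
    (v : ι → EReal) {b c : ℕ} (hbc : b ≤ c) (E : Set Ω) :
    μ.real (noExceed X v 0 b ∩ E) ≤
      μ.real (noExceed X v 0 c ∩ E) + (c - b : ℝ) * μ.real (belowEvent X 0 v)ᶜ := by
  have h1 : noExceed X v 0 b ∩ E ⊆
      (noExceed X v 0 c ∩ E) ∪ ⋃ i ∈ Finset.Ico b c, (belowEvent X i v)ᶜ := by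
    rintro ω ⟨hω, hE⟩
    by_cases h : ω ∈ noExceed X v 0 c
    · exact Or.inl ⟨h, hE⟩
    · right
      simp only [noExceed, Set.mem_ofPred_eq, not_forall] at h
      obtain ⟨i, h0, h1, h2⟩ := h
      simp only [Finset.mem_Ico, Set.mem_iUnion]
      exact ⟨i, ⟨not_lt.1 fun h3 => h2 (hω i h0 h3), h1⟩, h2⟩
  refine (measureReal_mono h1).trans ((measureReal_union_le _ _).trans ?_)
  gcongr
  refine (measureReal_biUnion_finset_le _ _).trans (le_of_eq ?_)
  simp only [measureReal_belowEvent_compl hs hX v]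
  rw [Finset.sum_const, Nat.card_Ico, nsmul_eq_mul, Nat.cast_sub hbc]

lemma abs_noExceed_sub_le (hs : IsStationary μ X) (hX : ∀ n j, Measurable (X n j))
    (v : ι → EReal) {b c : ℕ} (hbc : b ≤ c) (E : Set Ω) :
    |μ.real (noExceed X v 0 b ∩ E) - μ.real (noExceed X v 0 c ∩ E)| ≤
      (c - b : ℝ) * μ.real (belowEvent X 0 v)ᶜ := by
  have h1 := measureReal_noExceed_inter_le hs hX v hbc E
  have h2 : μ.real (noExceed X v 0 c ∩ E) ≤ μ.real (noExceed X v 0 b ∩ E) :=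
    measureReal_mono (Set.inter_subset_inter_left _ (noExceed_anti hbc))
  rw [abs_le]
  constructor <;> linarith

/-- Approximate independence of the maxima over adjacent blocks. -/
lemma abs_noExceed_add_sub_mul_le (hs : IsStationary μ X) (hX : ∀ n j, Measurable (X n j))
    (v : ι → EReal) (a b l : ℕ) :
    |μ.real (noExceed X v 0 (a + b)) - μ.real (noExceed X v 0 a) * μ.real (noExceed X v 0 b)| ≤
      2 * l * μ.real (belowEvent X 0 v)ᶜ + mixingCoeff μ X l := by
  have hq : 0 ≤ μ.real (belowEvent X 0 v)ᶜ := measureReal_nonneg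
  have hE2 : μ.real (noExceed X v a (a + b)) = μ.real (noExceed X v 0 b) := by
    have := measureReal_noExceed_shift hs hX v 0 b a
    rwa [zero_add, add_comm b] at this
  have hle : (a : ℝ) - (a - l : ℕ) ≤ l := by
    have : (a : ℝ) ≤ ((a - l : ℕ) : ℝ) + l := by exact_mod_cast (show a ≤ a - l + l by omega)
    linarith
  have h1 := abs_noExceed_sub_le hs hX v (Nat.sub_le a l) (noExceed X v a (a + b))
  rw [noExceed_inter 0 a (a + b) (zero_le) (Nat.le_add_right a b)] at h1
  have h2 := abs_noExceed_sub_le hs hX v (Nat.sub_le a l) Set.univ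
  rw [Set.inter_univ, Set.inter_univ] at h2
  have h3 := mul_le_mul_of_nonneg_right hle hq
  have h4 : |μ.real (noExceed X v 0 (a - l) ∩ noExceed X v a (a + b)) -
      μ.real (noExceed X v 0 (a - l)) * μ.real (noExceed X v a (a + b))| ≤ mixingCoeff μ X l := by
    rcases le_total a l with h | h
    · have h5 : noExceed X v 0 (a - l) = Set.univ := by
        rw [Nat.sub_eq_zero_of_le h, noExceed_eq_biInter]; simp
      rw [h5]
      simpa using mixingCoeff_nonneg l
    · refine le_csSup (mixingCoeff_set_bddAbove l) ⟨a - l, _, _, ?_, ?_, rfl⟩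
      · exact measurableSet_noExceed' fun i _ hi j => measurable_of_mem (Set.mem_Iic.2 hi.le) j
      · exact measurableSet_noExceed' fun i hi _ j =>
          measurable_of_mem (Set.mem_Ici.2 (by omega)) j
  rw [hE2] at h4
  have h5 : 0 ≤ μ.real (noExceed X v 0 b) := measureReal_nonneg
  have h6 : μ.real (noExceed X v 0 b) ≤ 1 := measureReal_le_one
  have h7 : |μ.real (noExceed X v 0 (a - l)) * μ.real (noExceed X v 0 b) -
      μ.real (noExceed X v 0 a) * μ.real (noExceed X v 0 b)| ≤
      l * μ.real (belowEvent X 0 v)ᶜ := by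
    rw [← sub_mul, abs_mul, abs_of_nonneg h5]
    exact (mul_le_of_le_one_right (abs_nonneg _) h6).trans (h2.trans h3)
  have h8 := h1.trans h3
  rw [abs_le] at *
  constructor <;> linarith

lemma abs_noExceed_mul_sub_pow_le (hs : IsStationary μ X) (hX : ∀ n j, Measurable (X n j))
    (v : ι → EReal) (m r l : ℕ) :
    |μ.real (noExceed X v 0 (m * r)) - μ.real (noExceed X v 0 r) ^ m| ≤
      m * (2 * l * μ.real (belowEvent X 0 v)ᶜ + mixingCoeff μ X l) := by
  induction m with
  | zero =>
    have : noExceed X v 0 (0 * r) = Set.univ := by rw [noExceed_eq_biInter]; simp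
    rw [this]
    simp
  | succ m ih =>
    have h1 := abs_noExceed_add_sub_mul_le hs hX v (m * r) r l
    have h5 : 0 ≤ μ.real (noExceed X v 0 r) := measureReal_nonneg
    have h6 : μ.real (noExceed X v 0 r) ≤ 1 := measureReal_le_one
    have h2 : |μ.real (noExceed X v 0 (m * r)) * μ.real (noExceed X v 0 r) -
        μ.real (noExceed X v 0 r) ^ m * μ.real (noExceed X v 0 r)| ≤
        m * (2 * l * μ.real (belowEvent X 0 v)ᶜ + mixingCoeff μ X l) := by
      rw [← sub_mul, abs_mul, abs_of_nonneg h5]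
      exact (mul_le_of_le_one_right (abs_nonneg _) h6).trans ih
    rw [Nat.succ_mul, pow_succ]
    push_cast
    rw [abs_le] at *
    constructor <;> linarith

lemma measureReal_noExceed_sub (hs : IsStationary μ X) (hX : ∀ n j, Measurable (X n j))
    (v : ι → EReal) (m : ℕ) :
    μ.real (noExceed X v 0 m) - μ.real (noExceed X v 0 (m + 1)) = μ.real (runEnd X v m) := by
  have h1 := measureReal_noExceed_shift hs hX v 0 m 1
  have h2 : noExceed X v 0 (m + 1) = noExceed X v 1 (m + 1) ∩ belowEvent X 0 v := by
    rw [← noExceed_inter 0 1 (m + 1) zero_le (Nat.le_add_left 1 m), Set.inter_comm]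
    congr 1
    rw [noExceed_eq_biInter]; simp
  have h3 := measureReal_inter_add_sdiff (μ := μ) (s := noExceed X v 1 (m + 1))
    (measurableSet_belowEvent hX 0 v)
  rw [zero_add] at h1
  rw [← h1, h2, ← h3, runEnd, Set.inter_comm (_)ᶜ, ← Set.sdiff_eq]
  ring

lemma one_sub_measureReal_noExceed (hs : IsStationary μ X) (hX : ∀ n j, Measurable (X n j))
    (v : ι → EReal) (r : ℕ) :
    1 - μ.real (noExceed X v 0 r) = ∑ m ∈ Finset.range r, μ.real (runEnd X v m) := by
  induction r with
  | zero =>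
    have : noExceed X v 0 0 = Set.univ := by rw [noExceed_eq_biInter]; simp
    simp [this]
  | succ r ih =>
    rw [Finset.sum_range_succ, ← ih, ← measureReal_noExceed_sub hs hX]
    ring

lemma abs_one_sub_noExceed_sub_le (hs : IsStationary μ X) (hX : ∀ n j, Measurable (X n j))
    {k : ℕ} (hk : 2 ≤ k) (v : ι → EReal) (r : ℕ) :
    |1 - μ.real (noExceed X v 0 r) - r * μ.real (runEnd X v (k - 1))| ≤
      k * μ.real (belowEvent X 0 v)ᶜ + r * ∑ i ∈ Finset.Icc k r,
        μ.real ((belowEvent X 0 v)ᶜ ∩ belowEvent X (i - 1) v ∩ (belowEvent X i v)ᶜ) := by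
  have h1 : (r : ℝ) * μ.real (runEnd X v (k - 1)) =
      ∑ m ∈ Finset.range r, μ.real (runEnd X v (k - 1)) := by simp
  rw [one_sub_measureReal_noExceed hs hX, h1, ← Finset.sum_sub_distrib]
  refine (Finset.abs_sum_le_sum_abs _ _).trans ((Finset.sum_le_sum fun m hm =>
    abs_runEnd_sub_le hk v (Finset.mem_range.1 hm)).trans ?_)
  rw [Finset.sum_add_distrib, Finset.sum_const, Finset.card_range, nsmul_eq_mul]
  gcongr
  rw [← Finset.sum_filter, Finset.sum_const, nsmul_eq_mul]
  gcongr
  refine (Finset.card_le_card (t := Finset.range k) fun m hm => ?_).trans_eq (Finset.card_range k)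
  exact Finset.mem_range.2 (Finset.mem_filter.1 hm).2

lemma tendsto_pow_of_tendsto_mul {m : ℕ → ℕ} {x : ℕ → ℝ} {c : ℝ} (hm : Tendsto m atTop atTop)
    (h : Tendsto (fun n => (m n : ℝ) * x n) atTop (𝓝 c)) :
    Tendsto (fun n => (1 - x n) ^ m n) atTop (𝓝 (Real.exp (-c))) := by
  have hm' : Tendsto (fun n => (m n : ℝ)) atTop atTop := tendsto_natCast_atTop_atTop.comp hm
  have hx : Tendsto x atTop (𝓝 0) := by
    have h1 := h.mul hm'.inv_tendsto_atTop
    rw [mul_zero] at h1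
    refine h1.congr' ?_
    filter_upwards [hm'.eventually_gt_atTop 0] with n hn
    simp only [Pi.inv_apply]
    field_simp
  have hlow : Tendsto (fun n => Real.exp (-(m n * x n / (1 - x n)))) atTop
      (𝓝 (Real.exp (-c))) := by
    have h1 := h.div (hx.const_sub 1) (by norm_num)
    rw [sub_zero, div_one] at h1
    exact (Real.continuous_exp.tendsto _).comp h1.neg
  have hup : Tendsto (fun n => Real.exp (-(m n * x n))) atTop (𝓝 (Real.exp (-c))) :=
    (Real.continuous_exp.tendsto _).comp h.neg
  refine tendsto_of_tendsto_of_tendsto_of_le_of_le' hlow hup ?_ ?_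
  · filter_upwards [hx.eventually (gt_mem_nhds one_pos)] with n hn
    have h1 : 0 < 1 - x n := by linarith
    have h2 : (1 - x n)⁻¹ ≤ Real.exp (x n / (1 - x n)) := by
      have := Real.add_one_le_exp (x n / (1 - x n))
      refine le_trans (le_of_eq ?_) this
      field_simp
      ring
    have h3 : Real.exp (-(x n / (1 - x n))) ≤ 1 - x n := by
      rw [Real.exp_neg]
      exact inv_le_of_inv_le₀ h1 h2
    calc Real.exp (-(m n * x n / (1 - x n))) = Real.exp (-(x n / (1 - x n))) ^ m n := by
          rw [← Real.exp_nat_mul]; ring_nf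
      _ ≤ _ := pow_le_pow_left₀ (Real.exp_pos _).le h3 _
  · filter_upwards [hx.eventually (gt_mem_nhds one_pos)] with n hn
    have h1 : 0 ≤ 1 - x n := by linarith
    calc (1 - x n) ^ m n ≤ Real.exp (-x n) ^ m n :=
          pow_le_pow_left₀ h1 (Real.one_sub_le_exp_neg _) _
      _ = _ := by rw [← Real.exp_nat_mul]; ring_nf

/-- Under `D^(k)(u_n)`, the distribution of the maxima is determined asymptotically by the
probability that an exceedance is followed by `k - 1` non-exceedances. -/
theorem ConditionD.tendsto_maxProb (hs : IsStationary μ X) (hX : ∀ n j, Measurable (X n j))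
    {k : ℕ} (hk : 2 ≤ k) {u : ℕ → ι → EReal} (hD : ConditionD μ X k u) {κ ν : ℝ}
    (hκ : Tendsto (fun n : ℕ => (n : ℝ) * μ.real (belowEvent X 0 (u n))ᶜ) atTop (𝓝 κ))
    (hν : Tendsto (fun n : ℕ => (n : ℝ) * μ.real (runEnd X (u n) (k - 1))) atTop (𝓝 ν)) :
    Tendsto (fun n => maxProb μ X n (u n)) atTop (𝓝 (Real.exp (-ν))) := by
  obtain ⟨m, l, hm, hnm, hml, hmα, hsum⟩ := hD
  simp only [maxProb_eq]
  set q : ℕ → ℝ := fun n => μ.real (belowEvent X 0 (u n))ᶜ with hq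
  set δ : ℕ → ℝ := fun n => ∑ i ∈ Finset.Icc k (n / m n),
      μ.real ((belowEvent X 0 (u n))ᶜ ∩ belowEvent X (i - 1) (u n) ∩ (belowEvent X i (u n))ᶜ)
    with hδ
  have hδ0 : ∀ n, 0 ≤ δ n := fun n => Finset.sum_nonneg fun _ _ => measureReal_nonneg
  have hq0 : ∀ n, 0 ≤ q n := fun n => measureReal_nonneg
  have hmq : Tendsto (fun n => (m n : ℝ) * q n) atTop (𝓝 0) := by
    have h1 := hnm.inv_tendsto_atTop.mul hκ
    rw [zero_mul] at h1
    refine h1.congr' ?_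
    filter_upwards [eventually_gt_atTop 0] with n hn
    have : (n : ℝ) ≠ 0 := by exact_mod_cast hn.ne'
    simp only [Pi.inv_apply, inv_div, hq]
    field_simp
  have hmod : ∀ᶠ n in atTop, (m n * (n / m n) : ℕ) ≤ n ∧
      (n : ℝ) - (m n * (n / m n) : ℕ) ≤ m n := by
    filter_upwards [hm.eventually_gt_atTop 0] with n hn
    refine ⟨Nat.mul_div_le n (m n), ?_⟩
    have h1 := Nat.div_add_mod n (m n)
    have h2 : n ≤ m n * (n / m n) + m n := by
      have := Nat.mod_lt n hn
      omega
    have h3 : (n : ℝ) ≤ ((m n * (n / m n) : ℕ) : ℝ) + m n := by exact_mod_cast h2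
    linarith
  have hstep1 : Tendsto (fun n => μ.real (noExceed X (u n) 0 (m n * (n / m n))) -
      μ.real (noExceed X (u n) 0 n)) atTop (𝓝 0) := by
    refine squeeze_zero_norm' ?_ hmq
    filter_upwards [hmod] with n hn
    have h1 := abs_noExceed_sub_le hs hX (u n) hn.1 Set.univ
    rw [Set.inter_univ, Set.inter_univ] at h1
    exact h1.trans (mul_le_mul_of_nonneg_right hn.2 (hq0 n))
  have hstep2 : Tendsto (fun n => μ.real (noExceed X (u n) 0 (m n * (n / m n))) -
      μ.real (noExceed X (u n) 0 (n / m n)) ^ m n) atTop (𝓝 0) := by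
    have h1 := ((hml.mul hκ).const_mul 2).add hmα
    rw [zero_mul, mul_zero, add_zero] at h1
    refine squeeze_zero_norm' ?_ h1
    filter_upwards [eventually_gt_atTop 0] with n hn
    have hn' : (n : ℝ) ≠ 0 := by exact_mod_cast hn.ne'
    refine (abs_noExceed_mul_sub_pow_le hs hX (u n) (m n) (n / m n) (l n)).trans (le_of_eq ?_)
    field_simp
  have hstep3 : Tendsto (fun n => (m n : ℝ) * (1 - μ.real (noExceed X (u n) 0 (n / m n)))) atTop
      (𝓝 ν) := by
    have hbound : Tendsto (fun n : ℕ => k * ((m n : ℝ) * q n) + n * δ n + m n * q n) atTop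
        (𝓝 0) := by
      have h1 := ((hmq.const_mul (k : ℝ)).add hsum).add hmq
      rwa [mul_zero, add_zero, add_zero] at h1
    have h2 : Tendsto (fun n : ℕ => (m n : ℝ) * (1 - μ.real (noExceed X (u n) 0 (n / m n))) -
        n * μ.real (runEnd X (u n) (k - 1))) atTop (𝓝 0) := by
      refine squeeze_zero_norm' ?_ hbound
      filter_upwards [hmod] with n hn
      have h3 := abs_one_sub_noExceed_sub_le hs hX hk (u n) (n / m n)
      have h4 : μ.real (runEnd X (u n) (k - 1)) ≤ q n := measureReal_mono Set.inter_subset_left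
      have h5 : 0 ≤ μ.real (runEnd X (u n) (k - 1)) := measureReal_nonneg
      have h6 : ((m n * (n / m n) : ℕ) : ℝ) ≤ n := by exact_mod_cast hn.1
      have h7 := mul_le_mul_of_nonneg_left h3 (Nat.cast_nonneg (α := ℝ) (m n))
      rw [← abs_of_nonneg (Nat.cast_nonneg (α := ℝ) (m n)), ← abs_mul,
        abs_of_nonneg (Nat.cast_nonneg (α := ℝ) (m n))] at h7
      have h8 : ((n : ℝ) - (m n * (n / m n) : ℕ)) * μ.real (runEnd X (u n) (k - 1)) ≤ m n * q n :=
        mul_le_mul hn.2 h4 h5 (Nat.cast_nonneg _)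
      have h9 : 0 ≤ ((n : ℝ) - (m n * (n / m n) : ℕ)) * μ.real (runEnd X (u n) (k - 1)) :=
        mul_nonneg (sub_nonneg.2 h6) h5
      have h10 := mul_le_mul_of_nonneg_right h6 (hδ0 n)
      change _ ≤ (m n : ℝ) * (k * q n + ((n / m n : ℕ) : ℝ) * δ n) at h7
      push_cast at h8 h9 h10
      rw [Real.norm_eq_abs, abs_le]
      rw [abs_le] at h7
      constructor <;> nlinarith [h7.1, h7.2]
    have h3 := h2.add hν
    rw [zero_add] at h3
    exact h3.congr fun n => sub_add_cancel _ _
  have hpow := tendsto_pow_of_tendsto_mul hm hstep3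
  simp only [sub_sub_cancel] at hpow
  have h := (hpow.add hstep2).sub hstep1
  rw [add_zero, sub_zero] at h
  exact h.congr fun n => by ring

end Extremal

section Levels

variable {Ω ι : Type*} [MeasurableSpace Ω] {μ : Measure Ω} {X : ℕ → ι → Ω → ℝ}

lemma measurableSet_upper {Z : Ω → ℝ} (hZ : Measurable Z) (v : EReal) :
    MeasurableSet {ω | v < (Z ω : EReal)} :=
  (measurable_coe_real_ereal.comp hZ) measurableSet_Ioi

lemma upper_nested {Ω : Type*} (Z : Ω → ℝ) (u v : EReal) :
    {ω | u < (Z ω : EReal)} ⊆ {ω | v < (Z ω : EReal)} ∨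
      {ω | v < (Z ω : EReal)} ⊆ {ω | u < (Z ω : EReal)} := by
  rcases le_total v u with h | h
  · exact Or.inl fun ω hω => h.trans_lt hω
  · exact Or.inr fun ω hω => h.trans_lt hω

lemma IsStationary.upperTail_mul (h : IsStationary μ X) (hX : ∀ n j, Measurable (X n j)) (i : ℕ)
    (j : ι) (t : ℝ) (v : EReal) :
    upperTail μ (fun ω => X i j ω * t) v = upperTail μ (fun ω => X 0 j ω * t) v := by
  have h1 := h.measureReal_shift hX i
    (measurableSet_upper ((measurable_coord (ι := ι) 0 j).mul_const t) v)
  simp only [path, zero_add, Set.mem_ofPred_eq] at h1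
  exact h1

lemma IsStationary.upperTail_eq (h : IsStationary μ X) (hX : ∀ n j, Measurable (X n j)) (i : ℕ)
    (j : ι) (v : EReal) : upperTail μ (X i j) v = upperTail μ (X 0 j) v := by
  simpa using h.upperTail_mul hX i j 1 v

variable [IsProbabilityMeasure μ]

lemma measureReal_sdiff_le_abs {A B : Set Ω} (hB : MeasurableSet B) (h : A ⊆ B ∨ B ⊆ A) :
    μ.real (A \ B) ≤ |μ.real A - μ.real B| := by
  rcases h with h | h
  · rw [Set.sdiff_eq_empty.2 h, measureReal_empty]
    exact abs_nonneg _
  · rw [measureReal_sdiff h hB]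
    exact le_abs_self _

variable [Fintype ι]

lemma measureReal_noExceed_le_of_levels (hs : IsStationary μ X) (hX : ∀ n j, Measurable (X n j))
    (u v : ι → EReal) (n : ℕ) :
    μ.real (noExceed X u 0 n) ≤ μ.real (noExceed X v 0 n) +
      ∑ j, |n * upperTail μ (X 0 j) (v j) - n * upperTail μ (X 0 j) (u j)| := by
  have h1 : noExceed X u 0 n ⊆ noExceed X v 0 n ∪ ⋃ i ∈ Finset.range n, ⋃ j,
      ({ω | v j < (X i j ω : EReal)} \ {ω | u j < (X i j ω : EReal)}) := by
    intro ω hω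
    by_cases h : ω ∈ noExceed X v 0 n
    · exact Or.inl h
    · right
      simp only [noExceed, belowEvent, Set.mem_ofPred_eq, not_forall, not_le] at h
      obtain ⟨i, h0, h1, j, h2⟩ := h
      simp only [Set.mem_iUnion, Finset.mem_range]
      exact ⟨i, h1, j, h2, not_lt.2 (hω i h0 h1 j)⟩
  refine (measureReal_mono h1).trans ((measureReal_union_le _ _).trans ?_)
  gcongr
  refine (measureReal_biUnion_finset_le _ _).trans ((Finset.sum_le_sum (g := fun _ =>
    ∑ j, |upperTail μ (X 0 j) (v j) - upperTail μ (X 0 j) (u j)|) fun i _ => ?_).trans_eq ?_)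
  · refine (measureReal_iUnion_fintype_le _).trans (Finset.sum_le_sum fun j _ => ?_)
    refine (measureReal_sdiff_le_abs (measurableSet_upper (hX i j) _)
      (upper_nested (X i j) _ _)).trans_eq ?_
    change |upperTail μ (X i j) (v j) - upperTail μ (X i j) (u j)| = _
    rw [hs.upperTail_eq hX i, hs.upperTail_eq hX i]
  · rw [Finset.sum_const, Finset.card_range, nsmul_eq_mul, Finset.mul_sum]
    refine Finset.sum_congr rfl fun j _ => ?_
    rw [← mul_sub, abs_mul, Nat.abs_cast]

/-- The asymptotic distribution of the maxima is the same for all normalized levels. -/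
lemma IsNormalizedLevels.tendsto_maxProb (hs : IsStationary μ X) (hX : ∀ n j, Measurable (X n j))
    {τ : ι → ℝ} {u v : ℕ → ι → EReal} (hu : IsNormalizedLevels μ X τ u)
    (hv : IsNormalizedLevels μ X τ v) {G : ℝ}
    (h : Tendsto (fun n => maxProb μ X n (u n)) atTop (𝓝 G)) :
    Tendsto (fun n => maxProb μ X n (v n)) atTop (𝓝 G) := by
  have h1 : Tendsto (fun n : ℕ => ∑ j, |n * upperTail μ (X 0 j) (v n j) -
      n * upperTail μ (X 0 j) (u n j)|) atTop (𝓝 0) := by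
    have h2 := tendsto_finsetSum Finset.univ fun j _ => ((hv j).sub (hu j)).abs
    simp only [sub_self, abs_zero, Finset.sum_const_zero] at h2
    exact h2
  have h2 : Tendsto (fun n => maxProb μ X n (v n) - maxProb μ X n (u n)) atTop (𝓝 0) := by
    refine squeeze_zero_norm (fun n => ?_) h1
    simp only [maxProb_eq]
    have h3 := measureReal_noExceed_le_of_levels hs hX (u n) (v n) n
    have h4 := measureReal_noExceed_le_of_levels hs hX (v n) (u n) n
    simp only [abs_sub_comm ((n : ℝ) * upperTail μ (X 0 _) (u n _))] at h4
    rw [Real.norm_eq_abs, abs_le]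
    constructor <;> linarith
  have h3 := h2.add h
  rw [zero_add] at h3
  exact h3.congr fun n => sub_add_cancel _ _

lemma iidMaxProb_eq (hX : ∀ n j, Measurable (X n j)) (n : ℕ) (v : ι → EReal) :
    iidMaxProb μ X n v = (1 - μ.real (belowEvent X 0 v)ᶜ) ^ n := by
  have hm : Measurable fun ω (j : ι) => X 0 j ω := measurable_pi_lambda _ (hX 0)
  have : IsProbabilityMeasure (μ.map fun ω (j : ι) => X 0 j ω) :=
    Measure.isProbabilityMeasure_map hm.aemeasurable
  have h1 : {m : Fin n → ι → ℝ | ∀ j, (Finset.univ.sup fun i : Fin n => (m i j : EReal)) ≤ v j} =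
      Set.univ.pi fun _ => {x : ι → ℝ | ∀ j, (x j : EReal) ≤ v j} := by
    ext m
    simp only [Finset.sup_le_iff, Finset.mem_univ, true_implies, Set.mem_ofPred_eq, Set.mem_pi,
      Set.mem_univ]
    exact forall_comm
  have h2 : MeasurableSet {x : ι → ℝ | ∀ j, (x j : EReal) ≤ v j} := by
    have h3 := measurableSet_belowEvent (X := fun (_ : ℕ) j (x : ι → ℝ) => x j)
      (fun _ j => measurable_pi_apply j) 0 v
    exact h3
  rw [iidMaxProb, h1, measureReal_def, Measure.pi_pi, Finset.prod_const, Finset.card_univ,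
    Fintype.card_fin, ENNReal.toReal_pow, Measure.map_apply hm h2,
    probReal_compl_eq_one_sub (measurableSet_belowEvent hX 0 v), sub_sub_cancel]
  rfl

lemma tendsto_iidMaxProb (hX : ∀ n j, Measurable (X n j)) {u : ℕ → ι → EReal} {κ : ℝ}
    (hκ : Tendsto (fun n : ℕ => (n : ℝ) * μ.real (belowEvent X 0 (u n))ᶜ) atTop (𝓝 κ)) :
    Tendsto (fun n => iidMaxProb μ X n (u n)) atTop (𝓝 (Real.exp (-κ))) := by
  simp only [iidMaxProb_eq hX]
  exact tendsto_pow_of_tendsto_mul tendsto_id hκ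

end Levels

section InclusionExclusion

variable {Ω : Type*} [MeasurableSpace Ω] {μ : Measure Ω} [IsProbabilityMeasure μ]

lemma measureReal_biUnion_eq_sum_erase {α : Type*} [DecidableEq α] (t : Finset α) {s : α → Set Ω}
    (hs : ∀ i, MeasurableSet (s i)) :
    μ.real (⋃ i ∈ t, s i) =
      ∑ u ∈ t.powerset.erase ∅, (-1) ^ (u.card + 1) * μ.real (⋂ i ∈ u, s i) := by
  rw [measureReal_biUnion_eq_sum_powerset (fun i _ => hs i)]
  refine Finset.sum_congr ?_ fun _ _ => rfl
  ext u
  simp [Finset.nonempty_iff_ne_empty, and_comm]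

variable {ι : Type*} {X : ℕ → ι → Ω → ℝ}

lemma measureReal_runEnd_eq [Countable ι] (hs : IsStationary μ X)
    (hX : ∀ n j, Measurable (X n j)) (k : ℕ) (v : ι → EReal) :
    μ.real (runEnd X v (k - 1)) = μ.real (belowEvent X 0 v)ᶜ -
      ∑ I ∈ (Finset.range (k - 1)).powerset.erase ∅, (-1) ^ (I.card + 1) *
        μ.real (⋂ i ∈ insert (k - 1) I, (belowEvent X i v)ᶜ) := by
  have hA : ∀ i, MeasurableSet (belowEvent X i v)ᶜ := fun i =>
      (measurableSet_belowEvent hX i v).compl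
  have h1 : ∑ I ∈ (Finset.range (k - 1)).powerset.erase ∅, (-1) ^ (I.card + 1) *
      μ.real (⋂ i ∈ insert (k - 1) I, (belowEvent X i v)ᶜ) =
      μ.real ((belowEvent X (k - 1) v)ᶜ ∩ ⋃ i ∈ Finset.range (k - 1), (belowEvent X i v)ᶜ) := by
    rw [Set.inter_iUnion₂, measureReal_biUnion_eq_sum_erase _ fun i => (hA (k - 1)).inter (hA i)]
    refine Finset.sum_congr rfl fun I hI => ?_
    have hne : I.Nonempty := Finset.nonempty_iff_ne_empty.2 (Finset.ne_of_mem_erase hI)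
    rw [Finset.set_biInter_insert]
    congr 2
    ext ω
    obtain ⟨i, hi⟩ := hne
    simp only [Set.mem_inter_iff, Set.mem_iInter]
    exact ⟨fun h i hi => ⟨h.1, h.2 i hi⟩, fun h => ⟨(h i hi).1, fun i hi => (h i hi).2⟩⟩
  have h2 : (belowEvent X (k - 1) v)ᶜ ∩ ⋃ i ∈ Finset.range (k - 1), (belowEvent X i v)ᶜ =
      (belowEvent X (k - 1) v)ᶜ \ noExceed X v 0 (k - 1) := by
    ext ω
    simp [noExceed]
  have h3 := measureReal_inter_add_sdiff (μ := μ) (s := (belowEvent X (k - 1) v)ᶜ)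
    (measurableSet_noExceed hX v 0 (k - 1))
  have h4 : noExceed X v 0 (k - 1 + 1) = noExceed X v 0 (k - 1) ∩ belowEvent X (k - 1) v := by
    rw [← noExceed_inter 0 (k - 1) (k - 1 + 1) zero_le (Nat.le_succ _)]
    congr 1
    rw [noExceed_eq_biInter]; simp
  have h5 := measureReal_inter_add_sdiff (μ := μ) (s := noExceed X v 0 (k - 1))
    (measurableSet_belowEvent hX (k - 1) v)
  rw [h1, h2, ← measureReal_noExceed_sub hs hX, h4, ← measureReal_belowEvent_compl hs hX v (k - 1)]
  rw [Set.inter_comm, ← Set.sdiff_eq] at h3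
  linarith

end InclusionExclusion

section TailFunctions

variable {Ω ι : Type*} [MeasurableSpace Ω] {μ : Measure Ω} {Y : ℕ → ι → Ω → ℝ}

lemma measurableSet_tailEvent (hY : ∀ n j, Measurable (Y n j)) (t : ℝ) (i : ℕ) (j : ι) (x : ℝ) :
    MeasurableSet (tailEvent μ Y t i j x) :=
  measurableSet_upper (hY i j) _

lemma tailEvent_mul {c t : ℝ} (hc : 0 < c) (i : ℕ) (j : ι) (x : ℝ) :
    tailEvent μ Y t i j (c * x) = tailEvent μ Y (t / c) i j x := by
  have hc' : ENNReal.ofReal c ≠ 0 := by simpa using hc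
  have h : ENNReal.ofReal t / ENNReal.ofReal (c * x) =
      ENNReal.ofReal (t / c) / ENNReal.ofReal x := by
    rw [ENNReal.ofReal_mul hc.le, ENNReal.ofReal_div_of_pos hc, div_eq_mul_inv, div_eq_mul_inv,
      div_eq_mul_inv, ENNReal.mul_inv (Or.inl hc') (Or.inl ENNReal.ofReal_ne_top), mul_assoc]
  simp only [tailEvent, h]

lemma preJointTail_mul {c : ℝ} (hc : 0 < c) (S : Finset ℕ) (x : ℕ → ι → ℝ) (t : ℝ) :
    preJointTail μ Y S (fun i j => c * x i j) t = c * preJointTail μ Y S x (t / c) := by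
  simp only [preJointTail, tailEvent_mul hc]
  field_simp

lemma jointTail_mul {c : ℝ} (hc : 0 < c) {S : Finset ℕ} {x : ℕ → ι → ℝ} {L : ℝ}
    (h : Tendsto (preJointTail μ Y S x) atTop (𝓝 L)) :
    jointTail μ Y S (fun i j => c * x i j) = c * jointTail μ Y S x := by
  have h1 : Tendsto (preJointTail μ Y S (fun i j => c * x i j)) atTop (𝓝 (c * L)) :=
    ((h.comp (tendsto_id.atTop_div_const hc)).const_mul c).congr fun t =>
      (preJointTail_mul hc S x t).symm
  rw [jointTail, jointTail, h1.limUnder_eq, h.limUnder_eq]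

lemma tailEvent_mono {t : ℝ} (i : ℕ) (j : ι) {x y : ℝ} (h : x ≤ y) :
    tailEvent μ Y t i j x ⊆ tailEvent μ Y t i j y := by
  intro ω hω
  simp only [tailEvent, Set.mem_ofPred_eq] at hω ⊢
  refine lt_of_le_of_lt (sInf_le_sInf (Set.image_mono fun z hz => ?_)) hω
  refine le_trans (tsub_le_tsub_left (ENNReal.inv_le_inv.2 ?_) 1) hz
  exact ENNReal.div_le_div_left (ENNReal.ofReal_le_ofReal h) _

lemma limUnder_congr {f g : ℝ → ℝ} (h : f =ᶠ[atTop] g) : limUnder atTop f = limUnder atTop g := by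
  rw [limUnder, limUnder, map_congr h]

lemma measureReal_tailEvent_shift [Countable ι] (hs : IsStationary μ Y)
    (hY : ∀ n j, Measurable (Y n j)) (S : Finset ℕ) (x : ℕ → ι → ℝ) (t : ℝ) (m : ℕ) :
    μ.real (⋂ i ∈ S, ⋃ j, tailEvent μ Y t (i + m) j (x i j)) =
      μ.real (⋂ i ∈ S, ⋃ j, tailEvent μ Y t i j (x i j)) := by
  have hB : MeasurableSet (⋂ i ∈ S, ⋃ j, {y : ℕ → ι → ℝ | tailQuantile μ (Y 0 j)
      (ENNReal.ofReal t / ENNReal.ofReal (x i j)) < (y i j : EReal)}) :=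
    Finset.measurableSet_biInter _ fun i _ => MeasurableSet.iUnion fun j =>
      measurableSet_upper (measurable_coord i j) _
  have h := hs.measureReal_shift hY m hB
  simp only [Set.mem_iInter, Set.mem_iUnion, Set.mem_ofPred_eq] at h
  convert h using 2
  · ext ω
    simp [tailEvent, path]
  · ext ω
    simp [tailEvent, path]

lemma preJointTail_singleton [Countable ι] (hs : IsStationary μ Y)
    (hY : ∀ n j, Measurable (Y n j)) (i : ℕ) (x : ι → ℝ) :
    preJointTail μ Y {i} (fun _ => x) = preJointTail μ Y {0} fun _ => x := by
  funext t
  have h := measureReal_tailEvent_shift hs hY {0} (fun _ => x) t i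
  simp only [Finset.mem_singleton, Set.iInter_iInter_eq_left, zero_add] at h
  simp only [preJointTail, Finset.mem_singleton, Set.iInter_iInter_eq_left, h]

lemma runSum_eq_sub_clusterSum (k : ℕ) (x : ℕ → ι → ℝ) :
    runSum μ Y k x = jointTail μ Y {k - 1} x - clusterSum μ Y k x := by
  have hmem : ∅ ∈ (Finset.range (k - 1)).powerset := Finset.empty_mem_powerset _
  rw [runSum, clusterSum, ← Finset.add_sum_erase _ _ hmem, sub_eq_add_neg, ← Finset.sum_neg_distrib]
  congr 1
  · simp
  · exact Finset.sum_congr rfl fun I _ => by ring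

variable [IsProbabilityMeasure μ]

lemma tailEvent_zero {β : ι → ℝ} (hY : ∀ n j, Measurable (Y n j))
    (hreg : ∀ j, IsRegVar μ (Y 0 j) (β j)) {t : ℝ} (ht : 0 < t) (i : ℕ) (j : ι) :
    tailEvent μ Y t i j 0 = ∅ := by
  simp only [tailEvent, ENNReal.ofReal_zero]
  rw [ENNReal.div_zero (by simpa using ht), tailQuantile_top (hreg j) (hY 0 j)]
  simp

lemma jointTail_single [DecidableEq ι] {β : ι → ℝ} (hY : ∀ n j, Measurable (Y n j))
    (hreg : ∀ j, IsRegVar μ (Y 0 j) (β j)) (S : Finset ℕ) (j : ι) (x : ℕ → ℝ) :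
    jointTail μ Y S (fun i => Pi.single j (x i)) = jointTail μ (marginal Y j) S fun i _ => x i := by
  refine limUnder_congr ?_
  filter_upwards [eventually_gt_atTop 0] with t ht
  simp only [preJointTail]
  congr 3
  funext i
  congr 1
  funext _
  ext ω
  simp only [Set.mem_iUnion]
  constructor
  · rintro ⟨j', h⟩
    rcases eq_or_ne j' j with rfl | hj
    · rw [Pi.single_eq_same] at h
      exact ⟨(), h⟩
    · rw [Pi.single_eq_of_ne hj, tailEvent_zero hY hreg ht] at h
      exact absurd h (Set.notMem_empty _)
  · rintro ⟨_, h⟩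
    exact ⟨j, by rw [Pi.single_eq_same]; exact h⟩

section UnionSum

variable [DecidableEq ι] {β : ι → ℝ}

lemma tendsto_union_tailEvent (hY : ∀ n j, Measurable (Y n j))
    (hreg : ∀ j, IsRegVar μ (Y 0 j) (β j))
    (hex : ∀ x : ι → ℝ, (∀ j, 0 ≤ x j) →
      ∃ L, Tendsto (preJointTail μ Y {0} fun _ => x) atTop (𝓝 L))
    {x : ι → ℝ} (hx : ∀ j, 0 ≤ x j) (J : Finset ι) :
    ∃ L, Tendsto (fun t : ℝ => t * μ.real (⋃ j ∈ J, tailEvent μ Y t 0 j (x j))) atTop (𝓝 L) := by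
  obtain ⟨L, hL⟩ := hex (fun j => if j ∈ J then x j else 0) fun j => by
    split_ifs
    exacts [hx j, le_rfl]
  refine ⟨L, hL.congr' ?_⟩
  filter_upwards [eventually_gt_atTop 0] with t ht
  simp only [preJointTail, Finset.mem_singleton, Set.iInter_iInter_eq_left]
  congr 3
  funext j
  by_cases hj : j ∈ J
  · simp [hj]
  · simp [hj, tailEvent_zero hY hreg ht]

lemma exists_tendsto_tailCopula (hY : ∀ n j, Measurable (Y n j))
    (hreg : ∀ j, IsRegVar μ (Y 0 j) (β j))
    (hex : ∀ x : ι → ℝ, (∀ j, 0 ≤ x j) →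
      ∃ L, Tendsto (preJointTail μ Y {0} fun _ => x) atTop (𝓝 L))
    {x : ι → ℝ} (hx : ∀ j, 0 ≤ x j) (J : Finset ι) (hJ : J ≠ ∅) :
    ∃ L, Tendsto (fun t : ℝ => t * μ.real (⋂ j ∈ J, tailEvent μ Y t 0 j (x j))) atTop (𝓝 L) := by
  induction J using Finset.strongInduction with
  | H J ih =>
    obtain ⟨L, hL⟩ := tendsto_union_tailEvent hY hreg hex hx J
    have h1 : ∀ I ∈ (J.powerset.erase ∅).erase J, ∃ M : ℝ,
        Tendsto (fun t : ℝ => (-1) ^ (I.card + 1) *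
          (t * μ.real (⋂ j ∈ I, tailEvent μ Y t 0 j (x j)))) atTop (𝓝 M) := fun I hI => by
      rw [Finset.mem_erase, Finset.mem_erase, Finset.mem_powerset] at hI
      obtain ⟨M, hM⟩ := ih I (hI.2.2.ssubset_of_ne hI.1) hI.2.1
      exact ⟨_, hM.const_mul _⟩
    choose! M hM using h1
    refine ⟨_, ((hL.sub (tendsto_finsetSum _ hM)).const_mul ((-1) ^ (J.card + 1))).congr
      fun t => ?_⟩
    have hmem : J ∈ J.powerset.erase ∅ := Finset.mem_erase.2 ⟨hJ, Finset.mem_powerset_self J⟩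
    rw [measureReal_biUnion_eq_sum_erase J fun j => measurableSet_tailEvent hY t 0 j (x j),
      Finset.mul_sum, ← Finset.add_sum_erase _ _ hmem]
    have h2 : ∀ I : Finset ι, t * ((-1) ^ (I.card + 1) *
        μ.real (⋂ j ∈ I, tailEvent μ Y t 0 j (x j))) = (-1) ^ (I.card + 1) *
          (t * μ.real (⋂ j ∈ I, tailEvent μ Y t 0 j (x j))) := fun I => by ring
    simp only [h2]
    rw [add_sub_cancel_right, ← mul_assoc, ← mul_pow, neg_one_mul, neg_neg, one_pow, one_mul]

/-- The exponent measure of the first vector in terms of the upper tail copulas. -/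
lemma unionSum_eq_jointTail [Fintype ι] (hY : ∀ n j, Measurable (Y n j))
    (hreg : ∀ j, IsRegVar μ (Y 0 j) (β j))
    (hex : ∀ x : ι → ℝ, (∀ j, 0 ≤ x j) →
      ∃ L, Tendsto (preJointTail μ Y {0} fun _ => x) atTop (𝓝 L))
    {x : ℕ → ι → ℝ} (hx : ∀ j, 0 ≤ x 0 j) :
    unionSum μ Y (x 0) = jointTail μ Y {0} x := by
  have h1 : ∀ I ∈ (Finset.univ : Finset ι).powerset.erase ∅,
      Tendsto (fun t : ℝ => (-1) ^ (I.card + 1) *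
        (t * μ.real (⋂ j ∈ I, tailEvent μ Y t 0 j (x 0 j)))) atTop
        (𝓝 ((-1) ^ (I.card - 1) * tailCopula μ Y I (x 0))) := fun I hI => by
    have hI' := Finset.ne_of_mem_erase hI
    obtain ⟨M, hM⟩ := exists_tendsto_tailCopula hY hreg hex hx I hI'
    have h3 : tailCopula μ Y I (x 0) = M := hM.limUnder_eq
    have h4 : I.card + 1 = I.card - 1 + 2 := by
      have := Finset.card_pos.2 (Finset.nonempty_iff_ne_empty.2 hI')
      omega
    rw [h3, h4, pow_add, neg_one_sq, mul_one]
    exact hM.const_mul _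
  have h2 := tendsto_finsetSum _ h1
  refine (Tendsto.limUnder_eq (h2.congr fun t => ?_)).symm
  have h3 := measureReal_biUnion_eq_sum_erase (μ := μ) Finset.univ fun j =>
    measurableSet_tailEvent (μ := μ) hY t 0 j (x 0 j)
  simp only [Finset.mem_univ, Set.iUnion_true] at h3
  simp only [preJointTail, Finset.mem_singleton, Set.iInter_iInter_eq_left]
  rw [h3, Finset.mul_sum]
  exact Finset.sum_congr rfl fun I _ => by ring

end UnionSum

/-- Tail independent vectors have vanishing joint tail functions. -/
lemma IsTailIndependent.jointTail_eq_zero [Fintype ι] {k : ℕ} (h : IsTailIndependent μ Y k)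
    (hs : IsStationary μ Y) (hY : ∀ n j, Measurable (Y n j)) {S : Finset ℕ} {i i' : ℕ}
    (hi : i ∈ S) (hi' : i' ∈ S) (hlt : i < i') (hk : i' < k) (x : ℕ → ι → ℝ) :
    jointTail μ Y S x = 0 := by
  obtain ⟨M, hM0, hMi, hMi'⟩ : ∃ M : ℝ, 0 < M ∧ (∀ j, x i j ≤ M) ∧ ∀ j, x i' j ≤ M := by
    have h1 : ∀ i j, |x i j| ≤ ∑ j, |x i j| := fun i j =>
      Finset.single_le_sum (f := fun j => |x i j|) (fun _ _ => abs_nonneg _) (Finset.mem_univ j)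
    have h0 : ∀ i, 0 ≤ ∑ j, |x i j| := fun i => Finset.sum_nonneg fun _ _ => abs_nonneg _
    refine ⟨1 + ∑ j, |x i j| + ∑ j, |x i' j|, by linarith [h0 i, h0 i'], fun j => ?_, fun j => ?_⟩
    · linarith [h1 i j, le_abs_self (x i j), h0 i']
    · linarith [h1 i' j, le_abs_self (x i' j), h0 i]
  have hlim : Tendsto (fun t : ℝ => M * ∑ j, ∑ j', t / M * μ.real
      (tailEvent μ Y (t / M) 0 j 1 ∩ tailEvent μ Y (t / M) (i' - i) j' 1)) atTop (𝓝 0) := by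
    have h1 := tendsto_finsetSum Finset.univ fun j _ => tendsto_finsetSum Finset.univ fun j' _ =>
      (h (i' - i) (by omega) (by omega) j j').comp (tendsto_id.atTop_div_const hM0)
    simpa using h1.const_mul M
  refine Tendsto.limUnder_eq (squeeze_zero' ?_ ?_ hlim)
  · filter_upwards [eventually_ge_atTop 0] with t ht using mul_nonneg ht measureReal_nonneg
  · filter_upwards [eventually_ge_atTop 0] with t ht
    have hsub : ⋂ i ∈ S, ⋃ j, tailEvent μ Y t i j (x i j) ⊆ ⋃ j, ⋃ j',
        (tailEvent μ Y (t / M) i j 1 ∩ tailEvent μ Y (t / M) i' j' 1) := by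
      intro ω hω
      simp only [Set.mem_iInter, Set.mem_iUnion] at hω ⊢
      obtain ⟨j, hj⟩ := hω i hi
      obtain ⟨j', hj'⟩ := hω i' hi'
      refine ⟨j, j', ?_, ?_⟩
      · rw [← tailEvent_mul hM0, mul_one]
        exact tailEvent_mono i j (hMi j) hj
      · rw [← tailEvent_mul hM0, mul_one]
        exact tailEvent_mono i' j' (hMi' j') hj'
    have hshift : ∀ j j', μ.real (tailEvent μ Y (t / M) i j 1 ∩ tailEvent μ Y (t / M) i' j' 1) =
        μ.real (tailEvent μ Y (t / M) 0 j 1 ∩ tailEvent μ Y (t / M) (i' - i) j' 1) := fun j j' => by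
      have h1 := hs.measureReal_shift hY i
        ((measurableSet_upper (measurable_coord (ι := ι) 0 j) (tailQuantile μ (Y 0 j)
          (ENNReal.ofReal (t / M) / ENNReal.ofReal 1))).inter
        (measurableSet_upper (measurable_coord (ι := ι) (i' - i) j') (tailQuantile μ (Y 0 j')
          (ENNReal.ofReal (t / M) / ENNReal.ofReal 1))))
      simp only [path, Set.mem_inter_iff, Set.mem_ofPred_eq, zero_add,
        Nat.sub_add_cancel hlt.le] at h1
      exact h1
    rw [Finset.mul_sum]
    simp only [Finset.mul_sum, ← mul_assoc, mul_div_cancel₀ t hM0.ne', ← hshift]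
    simp only [← Finset.mul_sum]
    refine mul_le_mul_of_nonneg_left ?_ ht
    refine (measureReal_mono hsub).trans ((measureReal_iUnion_fintype_le _).trans ?_)
    exact Finset.sum_le_sum fun j _ => measureReal_iUnion_fintype_le _

lemma IsTailIndependent.clusterSum_eq_zero [Fintype ι] {k : ℕ} (h : IsTailIndependent μ Y k)
    (hs : IsStationary μ Y) (hY : ∀ n j, Measurable (Y n j)) (x : ℕ → ι → ℝ) :
    clusterSum μ Y k x = 0 := by
  refine Finset.sum_eq_zero fun I hI => ?_
  rw [Finset.mem_erase, Finset.mem_powerset] at hI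
  obtain ⟨i, hi⟩ := Finset.nonempty_iff_ne_empty.2 hI.1
  have hlt := Finset.mem_range.1 (hI.2 hi)
  rw [h.jointTail_eq_zero hs hY (Finset.mem_insert_of_mem hi) (Finset.mem_insert_self _ _) hlt
    (by omega), mul_zero]

end TailFunctions

section JointLimit

variable {Ω ι : Type*} [MeasurableSpace Ω] {μ : Measure Ω} [IsProbabilityMeasure μ]
  {Y T : ℕ → ι → Ω → ℝ} {β : ι → ℝ} {τ : ι → ℝ} {u : ℕ → ι → EReal}

lemma belowEvent_compl_eq {Ω ι : Type*} (X : ℕ → ι → Ω → ℝ) (i : ℕ) (v : ι → EReal) :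
    (belowEvent X i v)ᶜ = ⋃ j, {ω | v j < (X i j ω : EReal)} := by
  ext ω
  simp [belowEvent]

lemma IsModel.tendsto_levels_top (h : IsModel μ Y T β)
    (hu : IsNormalizedLevels μ (mix Y T) τ u) (j : ι) :
    Tendsto (fun n => u n j) atTop (𝓝 ⊤) :=
  tendsto_top_of_upperTail (h.isRegVar_mix j) (tendsto_zero_of_nat_mul (hu j))

lemma IsModel.tendsto_upperTail_levels (h : IsModel μ Y T β)
    (hu : IsNormalizedLevels μ (mix Y T) τ u) (j : ι) :
    Tendsto (fun n : ℕ => (n : ℝ) * upperTail μ (Y 0 j) (u n j)) atTop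
      (𝓝 ((momentR μ T β j)⁻¹ * τ j)) := by
  refine tendsto_mul_of_tendsto_div upperTail_top upperTail_top
    (fun x => ((h.isRegVar_mix j).pos x).ne') ?_ (h.tendsto_levels_top hu j) (hu j)
  exact ((h.tendsto_breiman j).inv₀ (h.momentR_pos j).ne').congr fun x => by rw [inv_div]

variable [Fintype ι]

lemma measureReal_biInter_iUnion_le {S : Finset ℕ} {P Q : ℕ → ι → Set Ω}
    (hQ : ∀ i j, MeasurableSet (Q i j)) (hPQ : ∀ i j, P i j ⊆ Q i j ∨ Q i j ⊆ P i j) :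
    μ.real (⋂ i ∈ S, ⋃ j, P i j) ≤ μ.real (⋂ i ∈ S, ⋃ j, Q i j) +
      ∑ i ∈ S, ∑ j, |μ.real (P i j) - μ.real (Q i j)| := by
  have h1 : ⋂ i ∈ S, ⋃ j, P i j ⊆ (⋂ i ∈ S, ⋃ j, Q i j) ∪ ⋃ i ∈ S, ⋃ j, (P i j \ Q i j) := by
    intro ω hω
    by_cases h : ω ∈ ⋂ i ∈ S, ⋃ j, Q i j
    · exact Or.inl h
    · right
      simp only [Set.mem_iInter, Set.mem_iUnion, not_forall, not_exists] at h hω ⊢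
      obtain ⟨i, hi, h⟩ := h
      obtain ⟨j, hj⟩ := hω i hi
      exact ⟨i, hi, j, hj, h j⟩
  refine (measureReal_mono h1).trans ((measureReal_union_le _ _).trans ?_)
  gcongr
  refine (measureReal_biUnion_finset_le _ _).trans (Finset.sum_le_sum fun i _ => ?_)
  refine (measureReal_iUnion_fintype_le _).trans (Finset.sum_le_sum fun j _ => ?_)
  exact measureReal_sdiff_le_abs (hQ i j) (hPQ i j)

lemma abs_measureReal_biInter_iUnion_sub_le {S : Finset ℕ} {P Q : ℕ → ι → Set Ω}
    (hP : ∀ i j, MeasurableSet (P i j)) (hQ : ∀ i j, MeasurableSet (Q i j))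
    (hPQ : ∀ i j, P i j ⊆ Q i j ∨ Q i j ⊆ P i j) :
    |μ.real (⋂ i ∈ S, ⋃ j, P i j) - μ.real (⋂ i ∈ S, ⋃ j, Q i j)| ≤
      ∑ i ∈ S, ∑ j, |μ.real (P i j) - μ.real (Q i j)| := by
  have h1 := measureReal_biInter_iUnion_le (μ := μ) (S := S) hQ hPQ
  have h2 := measureReal_biInter_iUnion_le (μ := μ) (S := S) hP fun i j => (hPQ i j).symm
  simp only [abs_sub_comm (μ.real (Q _ _))] at h2
  rw [abs_le]
  constructor <;> linarith

/-- Conditionally on the second factor, the joint exceedance probabilities are asymptotically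
given by the joint tail function of the first factor. -/
lemma IsModel.tendsto_conditional (h : IsModel μ Y T β) (hτ : ∀ j, 0 ≤ τ j)
    (hu : IsNormalizedLevels μ (mix Y T) τ u) {S : Finset ℕ} {t : ℕ → ι → ℝ}
    (ht : ∀ i j, 0 ≤ t i j) {L : ℝ}
    (hL : Tendsto (preJointTail μ Y S fun i j => τ j * t i j ^ β j / momentR μ T β j) atTop
      (𝓝 L)) :
    Tendsto (fun n : ℕ => (n : ℝ) * μ.real (⋂ i ∈ S, ⋃ j,
      {ω | u n j < ((Y i j ω * t i j : ℝ) : EReal)})) atTop (𝓝 L) := by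
  have hx : ∀ i j, 0 ≤ τ j * t i j ^ β j / momentR μ T β j := fun i j =>
    div_nonneg (mul_nonneg (hτ j) (Real.rpow_nonneg (ht i j) _)) (h.momentR_pos j).le
  have hP : ∀ i j, Tendsto (fun n : ℕ => (n : ℝ) * upperTail μ (fun ω => Y i j ω * t i j) (u n j))
      atTop (𝓝 (τ j * t i j ^ β j / momentR μ T β j)) := fun i j => by
    have h1 := tendsto_mul_of_tendsto_div upperTail_top upperTail_top
      (fun x => ((h.isRegVar j).pos x).ne')
      ((h.isRegVar j).tendsto_scaled (h.beta_pos j) (ht i j)) (h.tendsto_levels_top hu j)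
      (h.tendsto_upperTail_levels hu j)
    simp only [h.stationary_Y.upperTail_mul h.measurable_Y i]
    convert h1 using 2
    ring
  have hQ : ∀ i j, Tendsto (fun n : ℕ => (n : ℝ) * μ.real (tailEvent μ Y n i j
      (τ j * t i j ^ β j / momentR μ T β j))) atTop
      (𝓝 (τ j * t i j ^ β j / momentR μ T β j)) := fun i j => by
    have h1 := (tendsto_mul_upperTail_tailQuantile_div (h.isRegVar j) (h.measurable_Y 0 j)
      (hx i j)).comp tendsto_natCast_atTop_atTop
    refine h1.congr fun n => ?_
    simp only [Function.comp]
    rw [← h.stationary_Y.upperTail_eq h.measurable_Y i]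
    rfl
  have hdiff : Tendsto (fun n : ℕ => ∑ i ∈ S, ∑ j,
      |(n : ℝ) * upperTail μ (fun ω => Y i j ω * t i j) (u n j) -
        n * μ.real (tailEvent μ Y n i j (τ j * t i j ^ β j / momentR μ T β j))|) atTop (𝓝 0) := by
    have h1 := tendsto_finsetSum S fun i _ => tendsto_finsetSum Finset.univ fun j _ =>
      ((hP i j).sub (hQ i j)).abs
    simpa only [sub_self, abs_zero, Finset.sum_const_zero] using h1
  have hL' := hL.comp tendsto_natCast_atTop_atTop
  have hzero : Tendsto (fun n : ℕ => (n : ℝ) * μ.real (⋂ i ∈ S, ⋃ j,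
      {ω | u n j < ((Y i j ω * t i j : ℝ) : EReal)}) -
      preJointTail μ Y S (fun i j => τ j * t i j ^ β j / momentR μ T β j) n) atTop (𝓝 0) := by
    have hpos : ∀ᶠ n in atTop, ∀ j, (0 : EReal) < u n j := eventually_all.2 fun j =>
      EReal.tendsto_nhds_top_iff_real.1 (h.tendsto_levels_top hu j) 0
    refine squeeze_zero_norm' ?_ hdiff
    filter_upwards [hpos, eventually_gt_atTop 0] with n hn hn0
    rw [preJointTail, ← mul_sub, norm_mul, Real.norm_of_nonneg (Nat.cast_nonneg _)]
    refine (mul_le_mul_of_nonneg_left (abs_measureReal_biInter_iUnion_sub_le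
      (fun i j => measurableSet_upper ((h.measurable_Y i j).mul_const _) _)
      (fun i j => measurableSet_tailEvent h.measurable_Y _ _ _ _) fun i j => ?_)
      (Nat.cast_nonneg _)).trans_eq ?_
    · rcases (ht i j).eq_or_lt with h0 | h0
      · refine Or.inl fun ω hω => ?_
        simp only [← h0, mul_zero, Set.mem_ofPred_eq, EReal.coe_zero] at hω
        exact absurd hω (hn j).not_gt
      · have hup : IsUpperSet {y : ℝ | u n j < ((y * t i j : ℝ) : EReal)} := fun a b hab ha =>
          lt_of_lt_of_le ha (EReal.coe_le_coe_iff.2 (mul_le_mul_of_nonneg_right hab h0.le))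
        have hup' : IsUpperSet {y : ℝ | tailQuantile μ (Y 0 j) (ENNReal.ofReal n /
            ENNReal.ofReal (τ j * t i j ^ β j / momentR μ T β j)) < (y : EReal)} :=
                fun a b hab ha =>
          lt_of_lt_of_le ha (EReal.coe_le_coe_iff.2 hab)
        rcases hup.total hup' with h1 | h1
        · exact Or.inl fun ω hω => h1 hω
        · exact Or.inr fun ω hω => h1 hω
    · simp only [Finset.mul_sum]
      refine Finset.sum_congr rfl fun i _ => Finset.sum_congr rfl fun j _ => ?_
      rw [← mul_sub, abs_mul, Nat.abs_cast]
      rfl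
  have h3 := hzero.add hL'
  rw [zero_add] at h3
  exact h3.congr fun n => sub_add_cancel _ _

/-- The joint exceedances of the scale mixture: `n P(X_i ≰ u_n for all i ∈ S)` converges to the
mean of the joint tail function of the first factor at random arguments. -/
theorem IsModel.tendsto_joint (h : IsModel μ Y T β) (hτ : ∀ j, 0 ≤ τ j)
    (hu : IsNormalizedLevels μ (mix Y T) τ u) {S : Finset ℕ} (hS : S.Nonempty)
    (hex : ∀ x : ℕ → ι → ℝ, (∀ i j, 0 ≤ x i j) → ∃ L, Tendsto (preJointTail μ Y S x) atTop (𝓝 L)) :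
    Integrable (fun ω => jointTail μ Y S fun i j => τ j * T i j ω ^ β j / momentR μ T β j) μ ∧
    Tendsto (fun n : ℕ => (n : ℝ) * μ.real (⋂ i ∈ S, (belowEvent (mix Y T) i (u n))ᶜ)) atTop
      (𝓝 (∫ ω, jointTail μ Y S (fun i j => τ j * T i j ω ^ β j / momentR μ T β j) ∂μ)) := by
  have hT : ∀ᵐ ω ∂μ, ∀ i j, 0 ≤ T i j ω := ae_all_iff.2 fun i => ae_all_iff.2 fun j =>
    h.nonneg_T i j
  have hB : ∀ n : ℕ, MeasurableSet (⋂ i ∈ S, ⋃ j, {p : (ℕ → ι → ℝ) × (ℕ → ι → ℝ) |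
      u n j < ((p.1 i j * p.2 i j : ℝ) : EReal)}) := fun n =>
    Finset.measurableSet_biInter _ fun i _ => MeasurableSet.iUnion fun j => measurableSet_upper
      (((measurable_coord i j).comp measurable_fst).mul
          ((measurable_coord i j).comp measurable_snd)) _
  have hY := measurable_path h.measurable_Y
  have hTm := measurable_path h.measurable_T
  have hsec : ∀ (n : ℕ) ω, {ω' | (path Y ω', path T ω) ∈ ⋂ i ∈ S, ⋃ j,
      {p : (ℕ → ι → ℝ) × (ℕ → ι → ℝ) | u n j < ((p.1 i j * p.2 i j : ℝ) : EReal)}} =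
      ⋂ i ∈ S, ⋃ j, {ω' | u n j < ((Y i j ω' * T i j ω : ℝ) : EReal)} := fun n ω => by
    ext ω'
    simp only [Set.mem_ofPred_eq, Set.mem_iInter, Set.mem_iUnion, path]
  have hmeas : ∀ n : ℕ, Measurable fun ω => (n : ℝ) * μ.real (⋂ i ∈ S, ⋃ j,
      {ω' | u n j < ((Y i j ω' * T i j ω : ℝ) : EReal)}) := fun n => by
    have h1 := measurable_measureReal_section (μ := μ) hY hTm (hB n)
    simp only [hsec] at h1
    exact h1.const_mul _
  have hint : ∀ n : ℕ, (n : ℝ) * μ.real (⋂ i ∈ S, (belowEvent (mix Y T) i (u n))ᶜ) =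
      ∫ ω, (n : ℝ) * μ.real (⋂ i ∈ S, ⋃ j,
        {ω' | u n j < ((Y i j ω' * T i j ω : ℝ) : EReal)}) ∂μ := fun n => by
    have h1 := measureReal_eq_integral_section (μ := μ) hY hTm h.indep (hB n)
    simp only [hsec] at h1
    rw [integral_const_mul, ← h1]
    congr 2
    ext ω
    simp only [belowEvent_compl_eq, Set.mem_ofPred_eq, Set.mem_iInter, Set.mem_iUnion, path, mix]
  simp only [hint]
  choose ε hε hεint using h.moment_T
  choose C x₀ hC hdom using fun j => (h.isRegVar j).exists_upperTail_mul_le (h.beta_pos j) (hε j)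
  obtain ⟨i₀, hi₀⟩ := hS
  refine integrable_and_tendsto_integral
    (bound := fun ω => ∑ j, C j * (1 + T i₀ j ω ^ ε j) * ((momentR μ T β j)⁻¹ * τ j + 1))
    (fun n => (hmeas n).aestronglyMeasurable) ?_ ?_ ?_
  · have hlev : ∀ᶠ n in atTop, ∀ j, (x₀ j : EReal) < u n j := eventually_all.2 fun j =>
      EReal.tendsto_nhds_top_iff_real.1 (h.tendsto_levels_top hu j) _
    have hlev' : ∀ᶠ n : ℕ in atTop, ∀ j, (n : ℝ) * upperTail μ (Y 0 j) (u n j) <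
        (momentR μ T β j)⁻¹ * τ j + 1 := eventually_all.2 fun j =>
      (h.tendsto_upperTail_levels hu j).eventually (gt_mem_nhds (lt_add_one _))
    filter_upwards [hlev, hlev'] with n hn hn'
    filter_upwards [hT] with ω hω
    rw [abs_of_nonneg (mul_nonneg (Nat.cast_nonneg _) measureReal_nonneg)]
    have h1 : μ.real (⋂ i ∈ S, ⋃ j, {ω' | u n j < ((Y i j ω' * T i j ω : ℝ) : EReal)}) ≤
        ∑ j, upperTail μ (fun ω' => Y i₀ j ω' * T i₀ j ω) (u n j) :=
      (measureReal_mono (Set.biInter_subset_of_mem hi₀)).trans (measureReal_iUnion_fintype_le _)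
    refine (mul_le_mul_of_nonneg_left h1 (Nat.cast_nonneg _)).trans ?_
    rw [Finset.mul_sum]
    refine Finset.sum_le_sum fun j _ => ?_
    rw [h.stationary_Y.upperTail_mul h.measurable_Y]
    have h2 := mul_le_mul_of_nonneg_left (hdom j (u n j) (hn j).le _ (hω i₀ j))
      (Nat.cast_nonneg (α := ℝ) n)
    have h3 : 0 ≤ C j * (1 + T i₀ j ω ^ ε j) :=
      mul_nonneg (hC j) (add_nonneg zero_le_one (Real.rpow_nonneg (hω i₀ j) _))
    have h4 := mul_le_mul_of_nonneg_left (hn' j).le h3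
    refine h2.trans (le_trans (le_of_eq ?_) h4)
    ring
  · exact integrable_finsetSum _ fun j _ =>
      (((integrable_const 1).add (h.integrable_rpow (hεint j) i₀)).const_mul _).mul_const _
  · filter_upwards [hT] with ω hω
    obtain ⟨L, hL⟩ := hex (fun i j => τ j * T i j ω ^ β j / momentR μ T β j) fun i j =>
      div_nonneg (mul_nonneg (hτ j) (Real.rpow_nonneg (hω i j) _)) (h.momentR_pos j).le
    have h1 : jointTail μ Y S (fun i j => τ j * T i j ω ^ β j / momentR μ T β j) = L :=
      hL.limUnder_eq
    rw [h1]
    exact h.tendsto_conditional hτ hu hω hL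

end JointLimit

section Assembly

variable {Ω ι : Type*} [MeasurableSpace Ω] {μ : Measure Ω}
  {Y T : ℕ → ι → Ω → ℝ} {β : ι → ℝ} {k : ℕ} {τ : ι → ℝ}

/-- The limits defining the joint tail functions `Λ_{(Y_1,…,Y_k)_{I ∪ {k}}}` exist. -/
def HasJointTails (μ : Measure Ω) (Y : ℕ → ι → Ω → ℝ) (k : ℕ) : Prop :=
  ∀ I : Finset ℕ, I ⊆ Finset.range (k - 1) → ∀ x : ℕ → ι → ℝ, (∀ i j, 0 ≤ x i j) →
    ∃ L : ℝ, Tendsto (preJointTail μ Y (insert (k - 1) I) x) atTop (𝓝 L)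

lemma HasJointTails.singleton [Countable ι] (hΛ : HasJointTails μ Y k) (hs : IsStationary μ Y)
    (hY : ∀ n j, Measurable (Y n j)) (x : ℕ → ι → ℝ) (hx : ∀ i j, 0 ≤ x i j) :
    ∃ L : ℝ, Tendsto (preJointTail μ Y {0} x) atTop (𝓝 L) := by
  obtain ⟨L, hL⟩ := hΛ ∅ (Finset.empty_subset _) (fun _ => x 0) fun _ => hx 0
  have h1 : preJointTail μ Y {0} x = preJointTail μ Y {0} fun _ => x 0 := by
    funext t
    simp [preJointTail]
  rw [insert_empty_eq, preJointTail_singleton hs hY, ← h1] at hL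
  exact ⟨L, hL⟩

lemma IsModel.ae_nonneg [Countable ι] (h : IsModel μ Y T β) : ∀ᵐ ω ∂μ, ∀ i j, 0 ≤ T i j ω :=
  ae_all_iff.2 fun i => ae_all_iff.2 fun j => h.nonneg_T i j

lemma IsModel.tendsto_exceed [IsProbabilityMeasure μ] [Fintype ι] [DecidableEq ι]
    (h : IsModel μ Y T β) (hΛ : HasJointTails μ Y k)
    (hτ : ∀ j, 0 ≤ τ j) {u : ℕ → ι → EReal} (hu : IsNormalizedLevels μ (mix Y T) τ u) :
    Tendsto (fun n : ℕ => (n : ℝ) * μ.real (belowEvent (mix Y T) 0 (u n))ᶜ) atTop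
      (𝓝 (∫ ω, unionSum μ Y (fun j => τ j * T 0 j ω ^ β j / momentR μ T β j) ∂μ)) := by
  have hex := hΛ.singleton h.stationary_Y h.measurable_Y
  have h1 := (h.tendsto_joint hτ hu (Finset.singleton_nonempty 0) hex).2
  simp only [Finset.mem_singleton, Set.iInter_iInter_eq_left] at h1
  convert h1 using 2
  refine integral_congr_ae ?_
  filter_upwards [h.ae_nonneg] with ω hω
  exact unionSum_eq_jointTail (x := fun i j => τ j * T i j ω ^ β j / momentR μ T β j)
    h.measurable_Y h.isRegVar (fun x hx => hex (fun _ => x) fun _ => hx) fun j =>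
      div_nonneg (mul_nonneg (hτ j) (Real.rpow_nonneg (hω 0 j) _)) (h.momentR_pos j).le

lemma IsModel.integrable_clusterSum [IsProbabilityMeasure μ] [Fintype ι] (h : IsModel μ Y T β)
    (hΛ : HasJointTails μ Y k)
    (hτ : ∀ j, 0 ≤ τ j) {u : ℕ → ι → EReal} (hu : IsNormalizedLevels μ (mix Y T) τ u) :
    Integrable (fun ω => clusterSum μ Y k
      fun i j => τ j * T i j ω ^ β j / momentR μ T β j) μ :=
  integrable_finsetSum _ fun I hI => ((h.tendsto_joint hτ hu (Finset.insert_nonempty _ _)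
    (hΛ I (Finset.mem_powerset.1 (Finset.mem_of_mem_erase hI)))).1).const_mul _

lemma IsModel.tendsto_runEnd [IsProbabilityMeasure μ] [Fintype ι] [DecidableEq ι]
    (h : IsModel μ Y T β) (hΛ : HasJointTails μ Y k)
    (hτ : ∀ j, 0 ≤ τ j) {u : ℕ → ι → EReal} (hu : IsNormalizedLevels μ (mix Y T) τ u) :
    Tendsto (fun n : ℕ => (n : ℝ) * μ.real (runEnd (mix Y T) (u n) (k - 1))) atTop
      (𝓝 ((∫ ω, unionSum μ Y (fun j => τ j * T 0 j ω ^ β j / momentR μ T β j) ∂μ) -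
        ∫ ω, clusterSum μ Y k (fun i j => τ j * T i j ω ^ β j / momentR μ T β j) ∂μ)) := by
  have hI := fun I (hI : I ∈ (Finset.range (k - 1)).powerset.erase ∅) =>
    h.tendsto_joint hτ hu (Finset.insert_nonempty _ _)
      (hΛ I (Finset.mem_powerset.1 (Finset.mem_of_mem_erase hI)))
  have h1 := (h.tendsto_exceed hΛ hτ hu).sub (tendsto_finsetSum _ fun I hI' =>
    (hI I hI').2.const_mul ((-1) ^ (I.card + 1)))
  have h2 : ∫ ω, clusterSum μ Y k (fun i j => τ j * T i j ω ^ β j / momentR μ T β j) ∂μ =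
      ∑ I ∈ (Finset.range (k - 1)).powerset.erase ∅, (-1) ^ (I.card + 1) *
        ∫ ω, jointTail μ Y (insert (k - 1) I)
          (fun i j => τ j * T i j ω ^ β j / momentR μ T β j) ∂μ := by
    simp only [clusterSum]
    rw [integral_finsetSum _ fun I hI' => ((hI I hI').1).const_mul _]
    exact Finset.sum_congr rfl fun I _ => integral_const_mul _ _
  rw [h2]
  refine h1.congr fun n => ?_
  rw [measureReal_runEnd_eq h.stationary_mix h.measurable_mix, mul_sub, Finset.mul_sum]
  congr 1
  exact Finset.sum_congr rfl fun I _ => by ring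

lemma IsModel.integral_runSum [IsProbabilityMeasure μ] [Fintype ι] [DecidableEq ι]
    (h : IsModel μ Y T β) (hΛ : HasJointTails μ Y k)
    (hτ : ∀ j, 0 ≤ τ j) {u : ℕ → ι → EReal} (hu : IsNormalizedLevels μ (mix Y T) τ u) :
    ∫ ω, runSum μ Y k (fun i j => τ j * T i j ω ^ β j / momentR μ T β j) ∂μ =
      (∫ ω, unionSum μ Y (fun j => τ j * T 0 j ω ^ β j / momentR μ T β j) ∂μ) -
        ∫ ω, clusterSum μ Y k (fun i j => τ j * T i j ω ^ β j / momentR μ T β j) ∂μ := by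
  obtain ⟨h1, h2⟩ := h.tendsto_joint hτ hu (Finset.singleton_nonempty (k - 1))
    (hΛ ∅ (Finset.empty_subset _))
  simp only [Finset.mem_singleton, Set.iInter_iInter_eq_left,
    measureReal_belowEvent_compl h.stationary_mix h.measurable_mix _ (k - 1)] at h2
  rw [tendsto_nhds_unique (h.tendsto_exceed hΛ hτ hu) h2,
    ← integral_sub h1 (h.integrable_clusterSum hΛ hτ hu)]
  simp only [runSum_eq_sub_clusterSum]

lemma IsModel.tendsto_maxProb [IsProbabilityMeasure μ] [Fintype ι] [DecidableEq ι]
    (h : IsModel μ Y T β) (hk : 2 ≤ k)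
    (hΛ : HasJointTails μ Y k) (hτ : ∀ j, 0 ≤ τ j) (hD : SatisfiesD μ (mix Y T) k τ)
    {u : ℕ → ι → EReal} (hu : IsNormalizedLevels μ (mix Y T) τ u) :
    Tendsto (fun n => maxProb μ (mix Y T) n (u n)) atTop (𝓝 (Real.exp
      (-((∫ ω, unionSum μ Y (fun j => τ j * T 0 j ω ^ β j / momentR μ T β j) ∂μ) -
        ∫ ω, clusterSum μ Y k (fun i j => τ j * T i j ω ^ β j / momentR μ T β j) ∂μ)))) := by
  obtain ⟨v, hv, hDv⟩ := hD
  exact hv.tendsto_maxProb h.stationary_mix h.measurable_mix hu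
    (hDv.tendsto_maxProb h.stationary_mix h.measurable_mix hk (h.tendsto_exceed hΛ hτ hv)
      (h.tendsto_runEnd hΛ hτ hv))

lemma IsModel.integral_unionSum_pos [IsProbabilityMeasure μ] [Fintype ι] [DecidableEq ι]
    (h : IsModel μ Y T β)
    (hΛ : HasJointTails μ Y k) (hτ : ∀ j, 0 ≤ τ j) (hτ0 : τ ≠ 0) {u : ℕ → ι → EReal}
    (hu : IsNormalizedLevels μ (mix Y T) τ u) :
    0 < ∫ ω, unionSum μ Y (fun j => τ j * T 0 j ω ^ β j / momentR μ T β j) ∂μ := by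
  obtain ⟨j, hj⟩ := Function.ne_iff.1 hτ0
  refine ((hτ j).lt_of_ne' hj).trans_le
    (le_of_tendsto_of_tendsto' (hu j) (h.tendsto_exceed hΛ hτ hu) fun n => ?_)
  refine mul_le_mul_of_nonneg_left (measureReal_mono fun ω hω => ?_) (Nat.cast_nonneg _)
  exact fun h1 => (h1 j).not_gt hω

lemma hasExtremalIndexAt_of_tendsto [IsProbabilityMeasure μ] {X : ℕ → ι → Ω → ℝ} {κ c : ℝ}
    (hκ : 0 < κ)
    (hex : ∃ u, IsNormalizedLevels μ X τ u)
    (h : ∀ u, IsNormalizedLevels μ X τ u →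
      Tendsto (fun n => maxProb μ X n (u n)) atTop (𝓝 (Real.exp (-(κ - c)))) ∧
      Tendsto (fun n => iidMaxProb μ X n (u n)) atTop (𝓝 (Real.exp (-κ)))) :
    HasExtremalIndexAt μ X τ (1 - c / κ) := by
  refine ⟨hex, _, _, Real.exp_pos _, Real.exp_pos _, by simpa using hκ, ?_, h⟩
  rw [Real.log_exp, Real.log_exp, neg_neg, neg_neg]
  field_simp

/-- The multivariate extremal index of a scale mixture. -/
theorem IsModel.hasExtremalIndexAt [IsProbabilityMeasure μ] [Fintype ι] [DecidableEq ι]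
    (h : IsModel μ Y T β) (hk : 2 ≤ k)
    (hΛ : HasJointTails μ Y k) (hτ : ∀ j, 0 ≤ τ j) (hτ0 : τ ≠ 0)
    (hD : SatisfiesD μ (mix Y T) k τ) :
    HasExtremalIndexAt μ (mix Y T) τ
      (1 - (∫ ω, clusterSum μ Y k (fun i j => τ j * T i j ω ^ β j / momentR μ T β j) ∂μ) /
        (∫ ω, unionSum μ Y (fun j => τ j * T 0 j ω ^ β j / momentR μ T β j) ∂μ)) := by
  obtain ⟨v, hv, -⟩ := id hD
  exact hasExtremalIndexAt_of_tendsto (h.integral_unionSum_pos hΛ hτ hτ0 hv) ⟨v, hv⟩ fun u hu =>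
    ⟨h.tendsto_maxProb hk hΛ hτ hD hu,
      tendsto_iidMaxProb h.measurable_mix (h.tendsto_exceed hΛ hτ hu)⟩

/-- The multivariate level which restricts only the `j`-th coordinate. -/
noncomputable def singleLevel [DecidableEq ι] (j : ι) (v : Unit → EReal) : ι → EReal :=
    fun j' => if j' = j then v () else ⊤

lemma belowEvent_marginal {Ω : Type*} [DecidableEq ι] (X : ℕ → ι → Ω → ℝ) (j : ι) (i : ℕ)
    (v : Unit → EReal) :
    belowEvent (marginal X j) i v = belowEvent X i (singleLevel j v) := by
  ext ω
  constructor
  · intro h j'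
    rcases eq_or_ne j' j with rfl | hj
    · simpa [singleLevel] using! h ()
    · simp [singleLevel, hj]
  · intro h _
    simpa [singleLevel] using! h j

lemma maxProb_marginal [DecidableEq ι] (X : ℕ → ι → Ω → ℝ) (j : ι) (n : ℕ) (v : Unit → EReal) :
    maxProb μ (marginal X j) n v = maxProb μ X n (singleLevel j v) := by
  simp only [maxProb_eq, noExceed, belowEvent_marginal]

lemma iidMaxProb_marginal [IsProbabilityMeasure μ] [Fintype ι] [DecidableEq ι] {X : ℕ → ι → Ω → ℝ}
    (hX : ∀ n j, Measurable (X n j)) (j : ι) (n : ℕ)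
    (v : Unit → EReal) : iidMaxProb μ (marginal X j) n v = iidMaxProb μ X n (singleLevel j v) := by
  rw [iidMaxProb_eq hX, iidMaxProb_eq (X := marginal X j) fun n _ => hX n j, belowEvent_marginal]

lemma IsNormalizedLevels.single [DecidableEq ι] {X : ℕ → ι → Ω → ℝ} {j : ι} {s : ℝ}
    {v : ℕ → Unit → EReal}
    (hv : IsNormalizedLevels μ (marginal X j) (fun _ => s) v) :
    IsNormalizedLevels μ X (Pi.single j s) fun n => singleLevel j (v n) := by
  intro j'
  rcases eq_or_ne j' j with rfl | hj
  · simpa [singleLevel] using! hv ()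
  · simp [singleLevel, hj]

lemma clusterSum_single [IsProbabilityMeasure μ] [DecidableEq ι] {β : ι → ℝ}
    (hY : ∀ n j, Measurable (Y n j))
    (hreg : ∀ j, IsRegVar μ (Y 0 j) (β j)) (j : ι) (x : ℕ → ℝ) :
    clusterSum μ Y k (fun i => Pi.single j (x i)) =
      clusterSum μ (marginal Y j) k fun i _ => x i := by
  simp only [clusterSum, jointTail_single hY hreg]

lemma HasJointTails.clusterSum_mul (hΛ : HasJointTails μ Y k) {c : ℝ} (hc : 0 < c)
    {x : ℕ → ι → ℝ} (hx : ∀ i j, 0 ≤ x i j) :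
    clusterSum μ Y k (fun i j => c * x i j) = c * clusterSum μ Y k x := by
  rw [clusterSum, clusterSum, Finset.mul_sum]
  refine Finset.sum_congr rfl fun I hI => ?_
  obtain ⟨L, hL⟩ := hΛ I (Finset.mem_powerset.1 (Finset.mem_of_mem_erase hI)) x hx
  rw [jointTail_mul hc hL]
  ring

/-- The extremal indices of the coordinates of a scale mixture. -/
theorem IsModel.hasExtremalIndex_marginal [IsProbabilityMeasure μ] [Fintype ι] [DecidableEq ι]
    (h : IsModel μ Y T β) (hk : 2 ≤ k)
    (hΛ : HasJointTails μ Y k) (j : ι)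
    (hD : ∀ s : ℝ, 0 < s → SatisfiesD μ (mix Y T) k (Pi.single j s)) :
    HasExtremalIndex μ (marginal (mix Y T) j) (1 - 1 / momentR μ T β j *
      ∫ ω, clusterSum μ (marginal Y j) k (fun i _ => T i j ω ^ β j) ∂μ) := by
  intro s hs
  have hτ : ∀ j', 0 ≤ (Pi.single j s : ι → ℝ) j' := fun j' => by
    rcases eq_or_ne j' j with rfl | hj
    · simpa using hs.le
    · simp [hj]
  have hr := h.momentR_pos j
  obtain ⟨u, hu, -⟩ := hD s hs
  have hv : IsNormalizedLevels μ (marginal (mix Y T) j) (fun _ => s) fun n _ => u n j := fun _ => by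
    simpa using! hu j
  have hκ : ∫ ω, unionSum μ Y (fun j' => (Pi.single j s : ι → ℝ) j' * T 0 j' ω ^ β j' /
      momentR μ T β j') ∂μ = s := by
    refine tendsto_nhds_unique (h.tendsto_exceed hΛ hτ hv.single) ((hv ()).congr fun n => ?_)
    rw [← belowEvent_marginal, belowEvent_compl_eq]
    congr 2
    ext ω
    exact ⟨fun h => Set.mem_iUnion.2 ⟨(), h⟩, fun h => (Set.mem_iUnion.1 h).choose_spec⟩
  have hc : ∫ ω, clusterSum μ Y k (fun i j' => (Pi.single j s : ι → ℝ) j' * T i j' ω ^ β j' /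
      momentR μ T β j') ∂μ = s / momentR μ T β j *
        ∫ ω, clusterSum μ (marginal Y j) k (fun i _ => T i j ω ^ β j) ∂μ := by
    rw [← integral_const_mul]
    refine integral_congr_ae ?_
    filter_upwards [h.ae_nonneg] with ω hω
    rw [← clusterSum_single h.measurable_Y h.isRegVar, ← hΛ.clusterSum_mul (div_pos hs hr)]
    · congr 1
      funext i j'
      rcases eq_or_ne j' j with rfl | hj
      · simp only [Pi.single_eq_same]
        ring
      · simp [hj]
    · intro i j'
      rcases eq_or_ne j' j with rfl | hj
      · simpa using Real.rpow_nonneg (hω i j') _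
      · simp [hj]
  have hθ : 1 - 1 / momentR μ T β j * ∫ ω, clusterSum μ (marginal Y j) k
      (fun i _ => T i j ω ^ β j) ∂μ = 1 - (s / momentR μ T β j *
        ∫ ω, clusterSum μ (marginal Y j) k (fun i _ => T i j ω ^ β j) ∂μ) / s := by
    field_simp
  rw [hθ]
  refine hasExtremalIndexAt_of_tendsto hs ⟨_, hv⟩ fun v hv => ?_
  have h1 := h.tendsto_maxProb hk hΛ hτ (hD s hs) hv.single
  have h2 := tendsto_iidMaxProb h.measurable_mix (h.tendsto_exceed hΛ hτ hv.single)
  rw [hκ] at h1 h2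
  rw [hc] at h1
  exact ⟨h1.congr fun n => (maxProb_marginal _ _ _ _).symm,
    h2.congr fun n => (iidMaxProb_marginal h.measurable_mix _ _ _).symm⟩

lemma IsModel.isNormalizedLevels_tailQuantile [IsProbabilityMeasure μ] (h : IsModel μ Y T β)
    {x : ι → ℝ}
    (hx : ∀ j, 0 < x j) :
    IsNormalizedLevels μ (mix Y T) (fun j => 1 / x j) fun (n : ℕ) j =>
      tailQuantile μ (mix Y T 0 j) (ENNReal.ofReal (n * x j)) := by
  intro j
  have h1 := ((tendsto_mul_upperTail_tailQuantile (h.isRegVar_mix j) (h.measurable_mix 0 j)).comp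
    (tendsto_natCast_atTop_atTop.atTop_mul_const (hx j))).const_mul (1 / x j)
  rw [mul_one] at h1
  refine h1.congr fun n => ?_
  have := (hx j).ne'
  simp only [Function.comp, upperTail]
  field_simp

end Assembly

end ScaleMixture

theorem mainTheorem1 {Ω : Type*} [MeasurableSpace Ω] (μ : Measure Ω) [IsProbabilityMeasure μ]
    (d k : ℕ) (hk : 2 ≤ k) (Y T : ℕ → Fin d → Ω → ℝ) (β : Fin d → ℝ)
    (hmodel : ScaleMixture.IsModel μ Y T β)
    (hmix : ScaleMixture.IsStrongMixing μ (ScaleMixture.mix Y T))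
    (hΛ : ∀ I : Finset ℕ, I ⊆ Finset.range (k - 1) →
      ∀ x : ℕ → Fin d → ℝ, (∀ i j, 0 ≤ x i j) →
        ∃ L : ℝ, Tendsto (ScaleMixture.preJointTail μ Y (insert (k - 1) I) x) atTop (𝓝 L)) :
    -- the multivariate extremal index
    (∀ τ : Fin d → ℝ, (∀ j, 0 ≤ τ j) → τ ≠ 0 →
      ScaleMixture.SatisfiesD μ (ScaleMixture.mix Y T) k τ →
      ScaleMixture.HasExtremalIndexAt μ (ScaleMixture.mix Y T) τ
        (1 - (∫ ω, ScaleMixture.clusterSum μ Y k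
                (fun i j => τ j * T i j ω ^ β j / ScaleMixture.momentR μ T β j) ∂μ) /
             (∫ ω, ScaleMixture.unionSum μ Y
                (fun j => τ j * T 0 j ω ^ β j / ScaleMixture.momentR μ T β j) ∂μ))) ∧
    -- the marginal extremal indices
    (∀ j : Fin d,
      (∀ s : ℝ, 0 < s → ScaleMixture.SatisfiesD μ (ScaleMixture.mix Y T) k (Pi.single j s)) →
      ScaleMixture.HasExtremalIndex μ (ScaleMixture.marginal (ScaleMixture.mix Y T) j)
        (1 - 1 / ScaleMixture.momentR μ T β j *
          ∫ ω, ScaleMixture.clusterSum μ (ScaleMixture.marginal Y j) k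
            (fun i _ => T i j ω ^ β j) ∂μ)) ∧
    -- the limiting distribution of the maxima
    (∀ x : Fin d → ℝ, (∀ j, 0 < x j) →
      ScaleMixture.SatisfiesD μ (ScaleMixture.mix Y T) k (fun j => 1 / x j) →
      Tendsto (fun n : ℕ => ScaleMixture.maxProb μ (ScaleMixture.mix Y T) n
          (fun j => ScaleMixture.tailQuantile μ (ScaleMixture.mix Y T 0 j)
            (ENNReal.ofReal (n * x j))))
        atTop
        (𝓝 (Real.exp (-∫ ω, ScaleMixture.runSum μ Y k
          (fun i j => T i j ω ^ β j / (ScaleMixture.momentR μ T β j * x j)) ∂μ)))) ∧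
    -- unit extremal indices under tail independence of the first factor
    (ScaleMixture.IsTailIndependent μ Y k →
      (∀ τ : Fin d → ℝ, (∀ j, 0 ≤ τ j) → τ ≠ 0 →
        ScaleMixture.SatisfiesD μ (ScaleMixture.mix Y T) k τ →
        ScaleMixture.HasExtremalIndexAt μ (ScaleMixture.mix Y T) τ 1) ∧
      (∀ j : Fin d,
        (∀ s : ℝ, 0 < s → ScaleMixture.SatisfiesD μ (ScaleMixture.mix Y T) k (Pi.single j s)) →
        ScaleMixture.HasExtremalIndex μ (ScaleMixture.marginal (ScaleMixture.mix Y T) j) 1)) := by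
  refine ⟨fun τ hτ hτ0 hD => hmodel.hasExtremalIndexAt hk hΛ hτ hτ0 hD,
    fun j hD => hmodel.hasExtremalIndex_marginal hk hΛ j hD, fun x hx hD => ?_,
    fun hind => ⟨fun τ hτ hτ0 hD => ?_, fun j hD => ?_⟩⟩
  · have hτ : ∀ j, 0 ≤ 1 / x j := fun j => (one_div_pos.2 (hx j)).le
    have hu := hmodel.isNormalizedLevels_tailQuantile hx
    have h := hmodel.tendsto_maxProb hk hΛ hτ hD hu
    rw [← hmodel.integral_runSum hΛ hτ hu] at h
    have harg : ∀ ω i j, T i j ω ^ β j / (ScaleMixture.momentR μ T β j * x j) =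
        1 / x j * T i j ω ^ β j / ScaleMixture.momentR μ T β j := fun ω i j => by ring
    simpa only [harg] using h
  · have h := hmodel.hasExtremalIndexAt hk hΛ hτ hτ0 hD
    simpa only [hind.clusterSum_eq_zero hmodel.stationary_Y hmodel.measurable_Y, integral_zero,
      zero_div, sub_zero] using h
  · have h := hmodel.hasExtremalIndex_marginal hk hΛ j hD
    simpa only [← ScaleMixture.clusterSum_single hmodel.measurable_Y hmodel.isRegVar,
      hind.clusterSum_eq_zero hmodel.stationary_Y hmodel.measurable_Y, integral_zero, mul_zero,
      sub_zero] using h
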